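/- **Conventions.** Let $E$ be a real Hausdorff locally convex topological vector space and $k\in\mathbb N_0\cup\{\infty\}$. A subset $U$ of a topological vector space is called locally convex if every $x\in U$ has a convex neighbourhood in $U$; it has dense interior if $U^\circ$ is dense in $U$. For a locally convex set $U\subseteq\mathbb R^s$ with dense interior, a map $g\colon U\to\mathbb R^t$ is $C^k$ if it is continuous and, for all $l\le k$ in $\mathbb N$, the iterated directional derivatives $d^{(l)}g(x,y_1,\dots,y_l)=(D_{y_l}\cdots D_{y_1}g)(x)$ exist for $x\in U^\circ$, $y_i\in\mathbb R^s$, are jointly continuous in $(x,y_1,\dots,y_l)$, and extend continuously to $U\times(\mathbb R^s)^l$. In particular $\partial^\gamma g\colon U\to\mathbb R^t$ is defined and continuous for $|\gamma|\le k$. *Whitney jets.* For a subset $A\subseteq\mathbb R^n$, a $k$-jet on $A$ is a family $f=(f_\alpha)_{|\alpha|\le k}$ of functions $f_\alpha\colon A\to E$, $\alpha\in(\mathbb N_0)^n$. For $l\le k$ in $\mathbb N_0$, $|\alpha|\le l$ and $x,y\in A$ put $$R_y^{l-|\alpha|}\partial^\alpha f(x)=f_\alpha(x)-\sum_{|\beta|\le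 l-|\alpha|}\frac{(x-y)^\beta}{\beta!}f_{\alpha+\beta}(y).$$ Let $\mathcal E^k(A,E)$ be the vector space of all $k$-jets $f$ such that for all $l\le k$ in $\mathbb N_0$, $|\alpha|\le l$, continuous seminorms $q$ on $E$, compact $K\subseteq A$ and $\varepsilon>0$ there is $\delta>0$ with $q(R_y^{l-|\alpha|}\partial^\alpha f(x))\le\varepsilon\|x-y\|^{l-|\alpha|}$ for all $x,y\in K$ with $0<\|x-y\|<\delta$. It carries the locally convex topology defined by the seminorms $$\|f\|_{\mathcal E^l,q,K}=\max_{|\alpha|\le l}\sup_{x\in K}q(f_\alpha(x))+\max_{|\alpha|\le l}\sup_{x\ne y\text{ in }K}\frac{q(R_y^{l-|\alpha|}\partial^\alpha f(x))}{\|x-y\|^{l-|\alpha|}}$$ with $l\le k$ in $\mathbb N_0$, $q$ a continuous seminorm on $E$ and $K\subseteq A$ compact (a supremum over the empty set is $0$). *Faà di Bruno polynomials.* Let $\alpha\in(\mathbb N_0)^s$ and $\beta\in(\mathbb N_0)^t$ with $|\beta|\le|\alpha|$, let $m=|\alpha|$ and $j=|\beta|$, and let $j_1\le\dots\le j_m$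 be the numbers in $\{1,\dots,s\}$ among which each $r$ occurs exactly $\alpha_r$ times. For $I\subseteq\{1,\dots,m\}$ let $(I)\in(\mathbb N_0)^s$ have entries $(I)_r=|\{i\in I: j_i=r\}|$. Put $$p_{\alpha,\beta}(x)=\sum_{\{I_1,\dots,I_j\}}\ \sum_{(i_1,\dots,i_j)}x_{(I_1),i_1}\cdots x_{(I_j),i_j},\qquad x=(x_{\gamma,i})_{|\gamma|\le|\alpha|,\,1\le i\le t},$$ where $\{I_1,\dots,I_j\}$ runs through the partitions of $\{1,\dots,m\}$ into $j$ nonempty sets and $(i_1,\dots,i_j)$ through the tuples in $\{1,\dots,t\}^j$ in which each $r$ occurs exactly $\beta_r$ times (so $p_{0,0}=1$, and $p_{\alpha,0}=0$ for $\alpha\neq0$). *Pullback.* Let $g\colon U\to V$ be a $C^k$ map between locally convex sets $U\subseteq\mathbb R^s$, $V\subseteq\mathbb R^t$ with dense interior, and let $A\subseteq U$, $B\subseteq V$ with $g(A)\subseteq B$. For a $k$-jet $f=(f_\beta)_{|\beta|\le k}$ on $B$ let $(g|_A)^*(f)$ be the $k$-jet on $A$ with $$\big((g|_A)^*(f)\big)_\alpha(x)=\sum_{|\beta|\le|\alpha|}p_{\alpha,\beta}\big((\partial^\gamma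 g(x))_{|\gamma|\le|\alpha|}\big)\,f_\beta(g(x))\qquad(x\in A,\ |\alpha|\le k).$$ **Theorem.** Let $U\subseteq\mathbb R^s$, $V\subseteq\mathbb R^t$ and $W\subseteq\mathbb R^u$ be locally convex sets with dense interior, $g\colon U\to V$ and $h\colon V\to W$ maps of class $C^k$, and $A\subseteq U$, $B\subseteq V$, $C\subseteq W$ subsets with $g(A)\subseteq B$ and $h(B)\subseteq C$. (a) For all $f\in\mathcal E^k(B,E)$ we have $(g|_A)^*(f)\in\mathcal E^k(A,E)$, and the map $(g|_A)^*\colon\mathcal E^k(B,E)\to\mathcal E^k(A,E)$ is linear and continuous. (b) The map $h\circ g\colon U\to W$ is $C^k$, and $(g|_A)^*\circ(h|_B)^*=((h\circ g)|_A)^*$ as maps $\mathcal E^k(C,E)\to\mathcal E^k(A,E)$. (c) The pullback $\mathcal E^k(A,E)\to\mathcal E^k(A,E)$ along $\mathrm{id}_U$ is the identity. More generally, for every subset $A'\subseteq A$ the pullback $\mathcal E^k(A,E)\to\mathcal E^k(A',E)$ along $\mathrm{id}_U$ is the restriction $f\mapsto f|_{A'}=(f_\alpha|_{A'})_{|\alpha|\le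 k}$. Moreover, if $g$ is a $C^k$-diffeomorphism from $U$ onto $V$ (bijective with $C^k$ inverse) and $g(A)=B$, then $(g|_A)^*\colon\mathcal E^k(B,E)\to\mathcal E^k(A,E)$ is an isomorphism of topological vector spaces with inverse $((g^{-1})|_B)^*$. -/

import Mathlib

open Set Filter Topology
open scoped Nat

namespace WhitneyPullback

noncomputable section

/-! ### Locally convex sets, `C^k` maps and partial derivatives -/

/-- The space `ℝⁿ` with the Euclidean norm. -/
abbrev Eucl (n : ℕ) : Type := EuclideanSpace ℝ (Fin n)

/-- Every point of `U` has a convex neighbourhood in `U`. -/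
def IsLocallyConvexSet {F : Type*} [AddCommGroup F] [Module ℝ F] [TopologicalSpace F]
    (U : Set F) : Prop :=
  ∀ x ∈ U, ∃ N : Set F, N ⊆ U ∧ N ∈ 𝓝[U] x ∧ Convex ℝ N

/-- The interior of `U` is dense in `U`. -/
def HasDenseInterior {F : Type*} [TopologicalSpace F] (U : Set F) : Prop :=
  U ⊆ closure (interior U)

section Calculus

variable {F E : Type*} [AddCommGroup F] [Module ℝ F] [TopologicalSpace F]
  [AddCommGroup E] [Module ℝ E] [TopologicalSpace E]

/-- `v` is the directional derivative of `f` at `x` in direction `y`, that is,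
`(f (x + t y) - f x) / t` tends to `v` as `t → 0`, `t ≠ 0`. -/
def HasDirDerivAt (f : F → E) (v : E) (x y : F) : Prop :=
  Tendsto (fun t : ℝ => t⁻¹ • (f (x + t • y) - f x)) (𝓝[≠] 0) (𝓝 v)

/-- The directional derivative `D_y f`, as a limit. -/
def dirDeriv (f : F → E) (y : F) : F → E := fun x =>
  limUnder (𝓝[≠] (0 : ℝ)) (fun t : ℝ => t⁻¹ • (f (x + t • y) - f x))

/-- The iterated directional derivative
`d^(l) f (x, y₁, …, y_l) = (D_{y_l} ⋯ D_{y₁} f) (x)`. -/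
def iterDirDeriv (f : F → E) : (l : ℕ) → (Fin l → F) → F → E
  | 0, _ => f
  | l + 1, y => dirDeriv (iterDirDeriv f l (Fin.init y)) (y (Fin.last l))

/-- `f` is of class `C^k` on `U` (meant for a locally convex set `U` with dense interior): `f` is
continuous on `U`, the iterated directional derivatives of order at most `k` exist at all points
of the interior of `U` and are jointly continuous there, and they extend continuously to `U`.
Only the values of `f` on `U` matter. -/
structure IsCk (k : ℕ∞) (f : F → E) (U : Set F) : Prop where
  continuousOn : ContinuousOn f U
  exists_dirDeriv : ∀ l : ℕ, ((l + 1 : ℕ) : ℕ∞) ≤ k → ∀ x ∈ interior U, ∀ y : Fin (l + 1) → F,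
    ∃ v, HasDirDerivAt (iterDirDeriv f l (Fin.init y)) v x (y (Fin.last l))
  continuousOn_iterDirDeriv : ∀ l : ℕ, (l : ℕ∞) ≤ k →
    ContinuousOn (fun p : F × (Fin l → F) => iterDirDeriv f l p.2 p.1) (interior U ×ˢ univ)
  exists_extension : ∀ l : ℕ, (l : ℕ∞) ≤ k →
    ∃ D : F × (Fin l → F) → E, ContinuousOn D (U ×ˢ univ) ∧
      ∀ x ∈ interior U, ∀ y : Fin l → F, D (x, y) = iterDirDeriv f l y x

end Calculus

/-- The order `|α| = α₁ + ⋯ + αₙ` of a multi-index. -/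
def order {n : ℕ} (α : Fin n → ℕ) : ℕ := ∑ i, α i

/-- The multi-indices in `(ℕ₀)ⁿ` of order at most `l`. -/
def multiLE (n l : ℕ) : Finset (Fin n → ℕ) :=
  (Fintype.piFinset fun _ => Finset.range (l + 1)).filter fun α => order α ≤ l

theorem mem_multiLE {n l : ℕ} {α : Fin n → ℕ} : α ∈ multiLE n l ↔ order α ≤ l := by
  simp only [multiLE, Finset.mem_filter, Fintype.mem_piFinset, Finset.mem_range, and_iff_right_iff_imp]
  intro h i
  exact Nat.lt_succ_of_le ((Finset.single_le_sum (fun j _ => Nat.zero_le (α j))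
    (Finset.mem_univ i)).trans h)

/-- For `k = |α|`, the nondecreasing sequence `j₁ ≤ ⋯ ≤ j_k` in which every `r` occurs exactly `α r` times. -/
def indexSeq {n : ℕ} (α : Fin n → ℕ) (l : Fin (order α)) : Fin n :=
  (finSigmaFinEquiv.symm l).1

/-- The partial derivative `∂^α f` on `U`, for `f` of class `C^{|α|}` on `U`: on the interior of `U`
it is the iterated derivative `d^(k) f (·, e_{j₁}, …, e_{j_k})` in the directions of the coordinate
vectors (their order is irrelevant for a `C^k` map, by symmetry), and it is extended continuously
to `U`. -/
def partialDeriv {n : ℕ} {E : Type*} [AddCommGroup E] [Module ℝ E] [TopologicalSpace E]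
    (U : Set (Eucl n)) (f : Eucl n → E) (α : Fin n → ℕ) : Eucl n → E :=
  extendFrom (interior U)
    (iterDirDeriv f (order α) fun l => EuclideanSpace.single (indexSeq α l) (1 : ℝ))

/-! ### Faà di Bruno polynomials -/

/-- For a block `I_m` of a partition of `{1, …, |α|}`, the multi-index `(I_m)` whose `r`-th entry is
the number of the `i ∈ I_m` with `j_i = r`. -/
def blockIndex {s : ℕ} (α : Fin s → ℕ) (P : OrderedFinpartition (order α)) (m : Fin P.length) :
    Fin s → ℕ :=
  fun r => (Finset.univ.filter fun a : Fin (P.partSize m) => indexSeq α (P.emb m a) = r).card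

/-- The Faà di Bruno polynomial
`p_{α,β}(x) = ∑_{P = {I₁, …, I_j}} ∑_{i₁, …, i_j} x_{(I₁), i₁} ⋯ x_{(I_j), i_j}`, where `j = |β|`, `P` runs
through the partitions of `{1, …, |α|}` into `j` nonempty blocks and `(i₁, …, i_j)` through the
tuples in which every `r` occurs exactly `β r` times. An `OrderedFinpartition` is a partition of
`Fin _` into nonempty blocks, with the blocks listed by increasing greatest element; the inner sum
does not depend on this choice. -/
def faaDiBruno {s t : ℕ} (α : Fin s → ℕ) (β : Fin t → ℕ) (x : (Fin s → ℕ) → Fin t → ℝ) : ℝ :=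
  ∑ P ∈ (Finset.univ : Finset (OrderedFinpartition (order α))).filter
      (fun P => P.length = order β),
    ∑ i ∈ (Finset.univ : Finset (Fin P.length → Fin t)).filter
      (fun i => ∀ r, (Finset.univ.filter fun m => i m = r).card = β r),
      ∏ m, x (blockIndex α P m) (i m)

theorem faaDiBruno_zero_zero {s t : ℕ} (x : (Fin s → ℕ) → Fin t → ℝ) :
    faaDiBruno (0 : Fin s → ℕ) (0 : Fin t → ℕ) x = 1 := by
  have key : ∀ P : OrderedFinpartition (order (0 : Fin s → ℕ)), P.length = 0 := by
    intro P
    have := P.length_le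
    simpa [order] using this
  have hs : Subsingleton (OrderedFinpartition (order (0 : Fin s → ℕ))) := by
    rw [show order (0 : Fin s → ℕ) = 0 by simp [order]]
    infer_instance
  obtain ⟨P₀⟩ : Nonempty (OrderedFinpartition (order (0 : Fin s → ℕ))) := ⟨default⟩
  have : IsEmpty (Fin P₀.length) := by
    rw [key]
    infer_instance
  unfold faaDiBruno
  rw [Finset.filter_true_of_mem (by intro P _; rw [key P]; simp [order]),
    show (Finset.univ : Finset (OrderedFinpartition (order (0 : Fin s → ℕ)))) = {P₀} from
      Finset.eq_singleton_iff_unique_mem.mpr ⟨Finset.mem_univ _, fun _ _ => Subsingleton.elim _ _⟩,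
    Finset.sum_singleton, Finset.filter_true_of_mem, Fintype.sum_unique, Finset.univ_eq_empty,
    Finset.prod_empty]
  intro i _ r
  rw [Finset.univ_eq_empty, Finset.filter_empty, Finset.card_empty]
  rfl

theorem faaDiBruno_zero_right {s t : ℕ} {α : Fin s → ℕ} (hα : α ≠ 0)
    (x : (Fin s → ℕ) → Fin t → ℝ) : faaDiBruno α (0 : Fin t → ℕ) x = 0 := by
  unfold faaDiBruno
  rw [Finset.filter_false_of_mem, Finset.sum_empty]
  intro P _ h
  apply hα
  have h0 : order α = 0 := by
    by_contra hne
    have := P.length_pos (Nat.pos_of_ne_zero hne)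
    simp [order] at h
    omega
  funext i
  exact (Finset.sum_eq_zero_iff.mp h0) i (Finset.mem_univ i)

/-! ### Jets -/

/-- A `k`-jet on `A ⊆ ℝⁿ` with values in `E`: a family `(f_α)_{|α| ≤ k}` of functions `A → E`. -/
def Jet {n : ℕ} (k : ℕ∞) (A : Set (Eucl n)) (E : Type*) : Type _ :=
  {α : Fin n → ℕ // (order α : ℕ∞) ≤ k} → A → E

namespace Jet

variable {n : ℕ} {k : ℕ∞} {A : Set (Eucl n)} {E : Type*} [AddCommGroup E] [Module ℝ E]

instance : AddCommGroup (Jet k A E) :=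
  inferInstanceAs (AddCommGroup ({α : Fin n → ℕ // (order α : ℕ∞) ≤ k} → A → E))

instance : Module ℝ (Jet k A E) :=
  inferInstanceAs (Module ℝ ({α : Fin n → ℕ // (order α : ℕ∞) ≤ k} → A → E))

/-- The value `f_α x`; the value `0` for `|α| > k` is a dummy. -/
def coeff (f : Jet k A E) (α : Fin n → ℕ) (x : A) : E :=
  if h : (order α : ℕ∞) ≤ k then f ⟨α, h⟩ x else 0

/-- The restriction of a jet to a subset. -/
def restrict {A' : Set (Eucl n)} (h : A' ⊆ A) (f : Jet k A E) : Jet k A' E :=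
  fun α x => f α ⟨x, h x.2⟩

/-- The `(k - |α|)`-jet `∂^α f = (f_{α + β})_{|β| ≤ k - |α|}`, for `|α| ≤ k`. -/
def shift (α : Fin n → ℕ) (f : Jet k A E) : Jet (k - order α) A E :=
  fun β x => f.coeff (α + β.1) x

/-- The Taylor polynomial `T_y^l f (x) = ∑_{|α| ≤ l} (x - y)^α / α! • f_α y`, for `l ≤ k`. -/
def taylor (l : ℕ) (f : Jet k A E) (y : A) (x : Eucl n) : E :=
  ∑ α ∈ multiLE n l,
    ((∏ i, (x i - (y : Eucl n) i) ^ α i) / ((∏ i, (α i)! : ℕ) : ℝ)) • f.coeff α y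

/-- The Taylor remainder `R_y^l f (x) = f_0 x - T_y^l f (x)`. -/
def remainder (l : ℕ) (f : Jet k A E) (y x : A) : E :=
  f.coeff 0 x - f.taylor l y x

theorem coeff_add (f g : Jet k A E) (α : Fin n → ℕ) (x : A) :
    (f + g).coeff α x = f.coeff α x + g.coeff α x := by
  unfold coeff
  split_ifs
  · rfl
  · simp

theorem coeff_smul (c : ℝ) (f : Jet k A E) (α : Fin n → ℕ) (x : A) :
    (c • f).coeff α x = c • f.coeff α x := by
  unfold coeff
  split_ifs
  · rfl
  · simp

theorem shift_add (α : Fin n → ℕ) (f g : Jet k A E) :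
    (f + g).shift α = f.shift α + g.shift α := by
  funext β x
  exact coeff_add f g _ x

theorem shift_smul (α : Fin n → ℕ) (c : ℝ) (f : Jet k A E) :
    (c • f).shift α = c • f.shift α := by
  funext β x
  exact coeff_smul c f _ x

theorem remainder_add (l : ℕ) (f g : Jet k A E) (y x : A) :
    (f + g).remainder l y x = f.remainder l y x + g.remainder l y x := by
  simp only [remainder, taylor, coeff_add, smul_add, Finset.sum_add_distrib]
  abel

theorem remainder_smul (l : ℕ) (c : ℝ) (f : Jet k A E) (y x : A) :
    (c • f).remainder l y x = c • f.remainder l y x := by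
  simp only [remainder, taylor, coeff_smul, smul_sub, Finset.smul_sum]
  congr 1
  exact Finset.sum_congr rfl fun α _ => smul_comm _ _ _

end Jet

/-! ### Whitney jets and their topology -/

section Whitney

variable {n : ℕ} {k : ℕ∞} {A : Set (Eucl n)} {E : Type*} [AddCommGroup E] [Module ℝ E]
  [TopologicalSpace E]

/-- `f` is a Whitney `k`-jet: for all `l ≤ k`, `|α| ≤ l`, continuous seminorms `q` and compact sets
`K ⊆ A`, the quotient `q (R_y^{l-|α|} ∂^α f (x)) / ‖x - y‖^{l-|α|}` tends to `0` uniformly in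
`x, y ∈ K` as `‖x - y‖ → 0`. -/
def IsWhitney (f : Jet k A E) : Prop :=
  ∀ l : ℕ, (l : ℕ∞) ≤ k → ∀ α : Fin n → ℕ, order α ≤ l →
    ∀ q : Seminorm ℝ E, Continuous q → ∀ K : Set A, IsCompact K → ∀ ε : ℝ, 0 < ε →
      ∃ δ : ℝ, 0 < δ ∧ ∀ x ∈ K, ∀ y ∈ K, 0 < ‖(x : Eucl n) - y‖ → ‖(x : Eucl n) - y‖ < δ →
        q ((f.shift α).remainder (l - order α) y x) / ‖(x : Eucl n) - y‖ ^ (l - order α) ≤ ε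

variable (k A E) in
/-- The space `𝓔^k(A, E)` of Whitney `k`-jets on `A` with values in `E`. -/
def WhitneyJets : Submodule ℝ (Jet k A E) where
  carrier := {f | IsWhitney f}
  add_mem' := by
    intro f g hf hg l hl α hα q hq K hK ε hε
    obtain ⟨δ₁, h₁, H₁⟩ := hf l hl α hα q hq K hK (ε / 2) (half_pos hε)
    obtain ⟨δ₂, h₂, H₂⟩ := hg l hl α hα q hq K hK (ε / 2) (half_pos hε)
    refine ⟨min δ₁ δ₂, lt_min h₁ h₂, fun x hx y hy h0 hlt => ?_⟩
    have a₁ := H₁ x hx y hy h0 (hlt.trans_le (min_le_left _ _))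
    have a₂ := H₂ x hx y hy h0 (hlt.trans_le (min_le_right _ _))
    rw [Jet.shift_add, Jet.remainder_add]
    calc _ ≤ (q ((f.shift α).remainder (l - order α) y x)
            + q ((g.shift α).remainder (l - order α) y x))
              / ‖(x : Eucl n) - y‖ ^ (l - order α) := by
          gcongr
          exact map_add_le_add q _ _
      _ ≤ ε := by
          rw [add_div]
          linarith
  zero_mem' := by
    intro l hl α hα q hq K hK ε hε
    refine ⟨1, one_pos, fun x _ y _ _ _ => ?_⟩
    have h : ((0 : Jet k A E).shift α).remainder (l - order α) y x = 0 := by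
      have := Jet.remainder_smul (l - order α) 0 ((0 : Jet k A E).shift α) y x
      rwa [← Jet.shift_smul, smul_zero, zero_smul] at this
    rw [h, map_zero, zero_div]
    exact hε.le
  smul_mem' := by
    intro c f hf l hl α hα q hq K hK ε hε
    have hc : 0 < |c| + 1 := by positivity
    obtain ⟨δ, hδ, H⟩ := hf l hl α hα q hq K hK (ε / (|c| + 1)) (div_pos hε hc)
    refine ⟨δ, hδ, fun x hx y hy h0 hlt => ?_⟩
    have a := H x hx y hy h0 hlt
    rw [Jet.shift_smul, Jet.remainder_smul, map_smul_eq_mul, mul_div_assoc, Real.norm_eq_abs]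
    calc _ ≤ |c| * (ε / (|c| + 1)) := by gcongr
      _ ≤ (|c| + 1) * (ε / (|c| + 1)) := by gcongr; linarith
      _ = ε := by field_simp

/-- The seminorm `max_{|α| ≤ l} sup_{x ∈ K} q (f_α x)`. -/
def supPart (l : ℕ) (q : Seminorm ℝ E) (K : Set A) (f : Jet k A E) : ℝ :=
  ⨆ p : {α : Fin n → ℕ // order α ≤ l} × K, q (f.coeff p.1 p.2)

/-- The seminorm
`max_{|α| ≤ l} sup {q (R_y^{l-|α|} ∂^α f (x)) / ‖x - y‖^{l-|α|} : x ≠ y in K}`. -/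
def remPart (l : ℕ) (q : Seminorm ℝ E) (K : Set A) (f : Jet k A E) : ℝ :=
  ⨆ p : {α : Fin n → ℕ // order α ≤ l} × {z : A × A // z.1 ∈ K ∧ z.2 ∈ K ∧ z.1 ≠ z.2},
    q ((f.shift p.1).remainder (l - order p.1.1) p.2.1.2 p.2.1.1)
      / ‖(p.2.1.1 : Eucl n) - p.2.1.2‖ ^ (l - order p.1.1)

instance finite_multi (l : ℕ) : Finite {α : Fin n → ℕ // order α ≤ l} :=
  ((multiLE n l).finite_toSet.subset (fun _ h => by
    simpa using mem_multiLE.mpr h) : {α : Fin n → ℕ | order α ≤ l}.Finite)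

theorem exists_bound_coeff {f : Jet k A E} (hf : IsWhitney f) {α : Fin n → ℕ}
    (hα : (order α : ℕ∞) ≤ k) {q : Seminorm ℝ E} (hq : Continuous q) {K : Set A}
    (hK : IsCompact K) : ∃ M : ℝ, 0 ≤ M ∧ ∀ x ∈ K, q (f.coeff α x) ≤ M := by
  obtain ⟨δ, hδ, H⟩ := hf (order α) hα α le_rfl q hq K hK 1 one_pos
  obtain ⟨T, hTK, hTf, hT⟩ := hK.totallyBounded.exists_subset (Metric.dist_mem_uniformity hδ)
  obtain ⟨M, hM⟩ := (hTf.image fun x => q (f.coeff α x)).bddAbove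
  refine ⟨max M 0 + 1, by positivity, fun x hx => ?_⟩
  obtain ⟨y, hy, hxy⟩ := mem_iUnion₂.mp (hT hx)
  have hMy : q (f.coeff α y) ≤ max M 0 := (hM ⟨y, hy, rfl⟩).trans (le_max_left _ _)
  have hd : ‖(x : Eucl n) - y‖ < δ := by
    rw [← dist_eq_norm]
    exact hxy
  rcases eq_or_ne x y with rfl | hne
  · linarith
  · have h0 : 0 < ‖(x : Eucl n) - y‖ := by
      rw [norm_pos_iff, sub_ne_zero]
      exact fun h => hne (Subtype.ext h)
    have h := H x hx y (hTK hy) h0 hd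
    have hrem : (f.shift α).remainder (order α - order α) y x = f.coeff α x - f.coeff α y := by
      have hm : multiLE n 0 = {0} := by
        ext β
        rw [mem_multiLE, Finset.mem_singleton]
        constructor
        · intro h
          funext i
          exact (Finset.sum_eq_zero_iff.mp (Nat.le_zero.mp h)) i (Finset.mem_univ i)
        · rintro rfl
          simp [order]
      have hc : ∀ z : A, (f.shift α).coeff 0 z = f.coeff α z := by
        intro z
        have h0 : ((order (0 : Fin n → ℕ) : ℕ) : ℕ∞) ≤ k - order α := by simp [order]
        rw [Jet.coeff, dif_pos h0]
        simp [Jet.shift]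
      simp [Jet.remainder, Jet.taylor, hm, hc]
    rw [hrem, Nat.sub_self, pow_zero, div_one] at h
    calc q (f.coeff α x) = q ((f.coeff α x - f.coeff α y) + f.coeff α y) := by
          rw [sub_add_cancel]
      _ ≤ q (f.coeff α x - f.coeff α y) + q (f.coeff α y) := map_add_le_add q _ _
      _ ≤ max M 0 + 1 := by linarith

theorem exists_bound_coeff_shift {f : Jet k A E} (hf : IsWhitney f) (α β : Fin n → ℕ)
    {q : Seminorm ℝ E} (hq : Continuous q) {K : Set A} (hK : IsCompact K) :
    ∃ M : ℝ, 0 ≤ M ∧ ∀ x ∈ K, q ((f.shift α).coeff β x) ≤ M := by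
  by_cases h : (order β : ℕ∞) ≤ k - order α
  · by_cases h' : (order (α + β) : ℕ∞) ≤ k
    · obtain ⟨M, hM0, hM⟩ := exists_bound_coeff hf h' hq hK
      refine ⟨M, hM0, fun x hx => ?_⟩
      rw [Jet.coeff, dif_pos h]
      exact hM x hx
    · refine ⟨0, le_rfl, fun x hx => ?_⟩
      rw [Jet.coeff, dif_pos h]
      simp [Jet.shift, Jet.coeff, h']
  · refine ⟨0, le_rfl, fun x hx => ?_⟩
    rw [Jet.coeff, dif_neg h, map_zero]

theorem exists_bound_remainder {f : Jet k A E} (hf : IsWhitney f) (l : ℕ) (α : Fin n → ℕ)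
    {q : Seminorm ℝ E} (hq : Continuous q) {K : Set A} (hK : IsCompact K) :
    ∃ M : ℝ, 0 ≤ M ∧ ∀ x ∈ K, ∀ y ∈ K, q ((f.shift α).remainder l y x) ≤ M := by
  choose M hM0 hM using fun β => exists_bound_coeff_shift hf α β hq hK
  have hc : ∀ β : Fin n → ℕ, ∃ C : ℝ, ∀ z ∈ K ×ˢ K,
      ‖(∏ i, ((z.1 : Eucl n) i - (z.2 : Eucl n) i) ^ β i) / ((∏ i, (β i)! : ℕ) : ℝ)‖ ≤ C := by
    intro β
    apply (hK.prod hK).exists_bound_of_continuousOn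
    apply Continuous.continuousOn
    fun_prop
  choose C hC using hc
  refine ⟨M 0 + ∑ β ∈ multiLE n l, |C β| * M β, ?_, fun x hx y hy => ?_⟩
  · exact add_nonneg (hM0 0) (Finset.sum_nonneg fun β _ => mul_nonneg (abs_nonneg _) (hM0 β))
  · unfold Jet.remainder Jet.taylor
    refine (map_sub_le_add q _ _).trans (add_le_add (hM 0 x hx) ?_)
    refine (Finset.le_sum_of_subadditive q (map_zero q).le (map_add_le_add q) _ _).trans
      (Finset.sum_le_sum fun β _ => ?_)
    rw [map_smul_eq_mul]
    exact mul_le_mul ((hC β (x, y) ⟨hx, hy⟩).trans (le_abs_self _)) (hM β y hy)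
      (apply_nonneg q _) (abs_nonneg _)

theorem bddAbove_supPart {f : Jet k A E} (hf : IsWhitney f) {l : ℕ} (hl : (l : ℕ∞) ≤ k)
    {q : Seminorm ℝ E} (hq : Continuous q) {K : Set A} (hK : IsCompact K) :
    BddAbove (range fun p : {α : Fin n → ℕ // order α ≤ l} × K => q (f.coeff p.1 p.2)) := by
  choose M hM0 hM using fun α : {α : Fin n → ℕ // order α ≤ l} =>
    exists_bound_coeff hf (α := α.1) ((Nat.cast_le.mpr α.2).trans hl) hq hK
  obtain ⟨B, hB⟩ := (finite_range M).bddAbove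
  refine ⟨B, ?_⟩
  rintro _ ⟨⟨α, x⟩, rfl⟩
  exact (hM α x x.2).trans (hB ⟨α, rfl⟩)

theorem bddAbove_remPart {f : Jet k A E} (hf : IsWhitney f) {l : ℕ} (hl : (l : ℕ∞) ≤ k)
    {q : Seminorm ℝ E} (hq : Continuous q) {K : Set A} (hK : IsCompact K) :
    BddAbove (range fun p : {α : Fin n → ℕ // order α ≤ l} ×
        {z : A × A // z.1 ∈ K ∧ z.2 ∈ K ∧ z.1 ≠ z.2} =>
      q ((f.shift p.1).remainder (l - order p.1.1) p.2.1.2 p.2.1.1)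
        / ‖(p.2.1.1 : Eucl n) - p.2.1.2‖ ^ (l - order p.1.1)) := by
  have key : ∀ α : {α : Fin n → ℕ // order α ≤ l}, ∃ M : ℝ, ∀ x ∈ K, ∀ y ∈ K, x ≠ y →
      q ((f.shift α.1).remainder (l - order α.1) y x)
        / ‖(x : Eucl n) - y‖ ^ (l - order α.1) ≤ M := by
    intro α
    obtain ⟨δ, hδ, H⟩ := hf l hl α.1 α.2 q hq K hK 1 one_pos
    obtain ⟨M, hM0, hM⟩ := exists_bound_remainder hf (l - order α.1) α.1 hq hK
    refine ⟨max 1 (M / δ ^ (l - order α.1)), fun x hx y hy hne => ?_⟩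
    have h0 : 0 < ‖(x : Eucl n) - y‖ := by
      rw [norm_pos_iff, sub_ne_zero]
      exact fun h => hne (Subtype.ext h)
    rcases lt_or_ge ‖(x : Eucl n) - y‖ δ with h | h
    · exact (H x hx y hy h0 h).trans (le_max_left _ _)
    · refine le_trans ?_ (le_max_right _ _)
      gcongr
      exact hM x hx y hy
  choose M hM using key
  obtain ⟨B, hB⟩ := (finite_range M).bddAbove
  refine ⟨B, ?_⟩
  rintro _ ⟨⟨α, ⟨⟨x, y⟩, hx, hy, hne⟩⟩, rfl⟩
  exact (hM α x hx y hy hne).trans (hB ⟨α, rfl⟩)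

/-- The seminorm `‖·‖_{𝓔^l, q, K}` on `𝓔^k(A, E)`, the sum of the two seminorms above. -/
def whitneySeminorm (l : ℕ) (hl : (l : ℕ∞) ≤ k) (q : Seminorm ℝ E) (hq : Continuous q)
    (K : Set A) (hK : IsCompact K) : Seminorm ℝ (WhitneyJets k A E) :=
  Seminorm.of (fun f => supPart l q K f.1 + remPart l q K f.1)
    (by
      intro f g
      have h₁ : supPart l q K (f + g).1 ≤ supPart l q K f.1 + supPart l q K g.1 := by
        refine Real.iSup_le (fun p => ?_) (add_nonneg
          (Real.iSup_nonneg fun _ => apply_nonneg q _) (Real.iSup_nonneg fun _ => apply_nonneg q _))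
        rw [Submodule.coe_add, Jet.coeff_add]
        exact (map_add_le_add q _ _).trans (add_le_add
          (le_ciSup (bddAbove_supPart f.2 hl hq hK) p) (le_ciSup (bddAbove_supPart g.2 hl hq hK) p))
      have h₂ : remPart l q K (f + g).1 ≤ remPart l q K f.1 + remPart l q K g.1 := by
        refine Real.iSup_le (fun p => ?_) (add_nonneg
          (Real.iSup_nonneg fun _ => by positivity) (Real.iSup_nonneg fun _ => by positivity))
        rw [Submodule.coe_add, Jet.shift_add, Jet.remainder_add]
        refine le_trans ?_ (add_le_add (le_ciSup (bddAbove_remPart f.2 hl hq hK) p)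
          (le_ciSup (bddAbove_remPart g.2 hl hq hK) p))
        rw [← add_div]
        gcongr
        exact map_add_le_add q _ _
      linarith)
    (by
      intro c f
      have h₁ : supPart l q K (c • f).1 = ‖c‖ * supPart l q K f.1 := by
        unfold supPart
        rw [Real.mul_iSup_of_nonneg (norm_nonneg c)]
        refine iSup_congr fun p => ?_
        rw [Submodule.coe_smul, Jet.coeff_smul, map_smul_eq_mul]
      have h₂ : remPart l q K (c • f).1 = ‖c‖ * remPart l q K f.1 := by
        unfold remPart
        rw [Real.mul_iSup_of_nonneg (norm_nonneg c)]
        refine iSup_congr fun p => ?_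
        rw [Submodule.coe_smul, Jet.shift_smul, Jet.remainder_smul, map_smul_eq_mul, mul_div_assoc]
      rw [h₁, h₂, mul_add])

variable (k A E) in
/-- The triples `(l, q, K)` of an `l ≤ k` in `ℕ₀`, a continuous seminorm `q` on `E` and a compact
set `K ⊆ A`. -/
structure SeminormIndex where
  l : ℕ
  hl : (l : ℕ∞) ≤ k
  q : Seminorm ℝ E
  hq : Continuous q
  K : Set A
  hK : IsCompact K

variable (k A E) in
/-- The family of all seminorms `‖·‖_{𝓔^l, q, K}`. -/
def whitneyFamily : SeminormFamily ℝ (WhitneyJets k A E) (SeminormIndex k A E) :=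
  fun i => whitneySeminorm i.l i.hl i.q i.hq i.K i.hK

/-- The locally convex topology on `𝓔^k(A, E)` generated by the seminorms `‖·‖_{𝓔^l, q, K}`. -/
instance : TopologicalSpace (WhitneyJets k A E) :=
  (whitneyFamily k A E).moduleFilterBasis.topology

theorem withSeminorms_whitneyFamily : WithSeminorms (whitneyFamily k A E) :=
  ⟨rfl⟩

end Whitney

/-! ### The pullback -/

/-- The pullback
`(g|_A)^* f = (x ↦ ∑_{|β| ≤ |α|} p_{α,β}((∂^γ g (x))_γ) • f_β (g x))_{|α| ≤ k}` of a jet on `B` along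
a map `g` on `U` with `g(A) ⊆ B` (for `A ⊆ U` and `g` of class `C^k` on `U`). -/
def pullback {s t : ℕ} {k : ℕ∞} {E : Type*} [AddCommGroup E] [Module ℝ E]
    (U : Set (Eucl s)) (g : Eucl s → Eucl t) {A : Set (Eucl s)} {B : Set (Eucl t)}
    (hAB : MapsTo g A B) (f : Jet k B E) : Jet k A E :=
  fun α x => ∑ β ∈ multiLE t (order α.1),
    faaDiBruno α.1 β (fun γ i => partialDeriv U g γ x i) • f.coeff β ⟨g x, hAB x.2⟩

end

end WhitneyPullback

open WhitneyPullback

namespace WhitneyPullback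

noncomputable section

/-! ### Calculus on locally convex sets with dense interior -/

section LocallyConvex

variable {F : Type*} [NormedAddCommGroup F] [NormedSpace ℝ F]

/-! The jet `(g|_A)^* f` is what the Faà di Bruno formula prescribes for the derivatives of `f ∘ g`.
The proof makes this exact for polynomials and controls the error by Taylor's theorem.

Calculus on `U`: near each of its points `U` contains a convex set with interior points, so
derivatives within `U` are unique. The mean value inequality then shows that a continuous extension
of the derivative from the interior is the derivative within `U`. Hence `IsCk` amounts to
`ContDiffOn` (`IsCk.contDiffOn`, `ContDiffOn.isCk`), the extended partial derivatives are iterated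
derivatives within `U` (`partialDeriv_eq_multiDeriv`), and the chain rule takes its multivariate
form (`multiDeriv_comp`).

Whitney condition: expand every `f_β (g x)` about `g y`. The Taylor remainders of `f` give one sum.
The polynomial parts are derivatives of the functions `(g - g y)^κ / κ!`, and subtracting the Taylor
polynomial of the pullback at `y` turns them into remainders of the jets of these functions, with
coefficients `f_κ (g y)` (`remainder_pullback`). The first sum is small because `f` is a Whitney jet
and `g` is Lipschitz on compact sets. The second is small because jets of `C^k` functions are
Whitney jets (`isWhitney_jetOf`); for this, `(g - g y)^κ / κ!` is expanded into monomials of `g`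
with coefficients depending only on `y`, which leaves finitely many functions independent of `y`.
The same identity bounds each seminorm of the pullback by a seminorm of `f` over `g(K)`, which is
continuity.

Functoriality: `p_{α,γ}` evaluated at the derivatives of `g` at `x` is the `α`-th derivative at `x`
of `(g - g x)^γ / γ!`. Applying the chain rule to `(h - h (g x))^γ / γ!` composed with `g` gives the
composition law for these coefficients (`faaDiBruno_comp`). For the identity they are Kronecker
deltas, and the remaining claims follow. -/

theorem IsLocallyConvexSet.exists_convex_nhds {U : Set F} (hU : IsLocallyConvexSet U)
    (hU' : HasDenseInterior U) {x : F} (hx : x ∈ U) :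
    ∃ N ⊆ U, N ∈ 𝓝[U] x ∧ Convex ℝ N ∧ (interior N).Nonempty := by
  obtain ⟨N, hNU, hN, hc⟩ := hU x hx
  refine ⟨N, hNU, hN, hc, ?_⟩
  obtain ⟨O, hO, hxO, hON⟩ := mem_nhdsWithin.mp hN
  obtain ⟨z, hzO, hzU⟩ := mem_closure_iff.mp (hU' hx) O hO hxO
  exact ⟨z, mem_interior.mpr ⟨O ∩ interior U,
    (inter_subset_inter_right _ interior_subset).trans hON, hO.inter isOpen_interior, hzO, hzU⟩⟩

/-- A convex set with interior points has unique derivatives at all points of its closure, and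
unique differentiability passes to larger sets. -/
theorem IsLocallyConvexSet.uniqueDiffOn {U : Set F} (hU : IsLocallyConvexSet U)
    (hU' : HasDenseInterior U) : UniqueDiffOn ℝ U := by
  intro x hx
  obtain ⟨N, hNU, hN, hc, hi⟩ := hU.exists_convex_nhds hU' hx
  exact (uniqueDiffWithinAt_convex hc hi (subset_closure (mem_of_mem_nhdsWithin hx hN))).mono hNU

theorem IsLocallyConvexSet.locallyLipschitzOn {G : Type*} [NormedAddCommGroup G] [NormedSpace ℝ G]
    {U : Set F} (hU : IsLocallyConvexSet U) {f : F → G} (hf : ContDiffOn ℝ 1 f U) :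
    LocallyLipschitzOn U f := by
  intro x hx
  obtain ⟨N, hNU, hN, hc⟩ := hU x hx
  obtain ⟨K, t, ht, hft⟩ :=
    ((hf x hx).mono hNU).exists_lipschitzOnWith hc
  exact ⟨K, t, nhdsWithin_le_of_mem hN ht, hft⟩

/-- A continuous extension of the derivative from the interior is the derivative within the set. -/
theorem IsLocallyConvexSet.hasFDerivWithinAt_of_continuousOn {G : Type*} [NormedAddCommGroup G]
    [NormedSpace ℝ G] {U : Set F} (hU : IsLocallyConvexSet U) (hU' : HasDenseInterior U)
    {f : F → G} {f' : F → F →L[ℝ] G} (hf : ContinuousOn f U) (hf' : ContinuousOn f' U)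
    (h : ∀ x ∈ interior U, HasFDerivAt f (f' x) x) {x : F} (hx : x ∈ U) :
    HasFDerivWithinAt f (f' x) U x := by
  obtain ⟨N, hNU, hN, hc, hi⟩ := hU.exists_convex_nhds hU' hx
  rw [hasFDerivWithinAt_iff_isLittleO, Asymptotics.isLittleO_iff]
  intro ε hε
  obtain ⟨δ, hδ, H⟩ := Metric.continuousWithinAt_iff.mp (hf' x hx) ε hε
  -- On this convex set `f` is differentiable with derivative within `ε` of `f' x`, so the mean
  -- value inequality yields the estimate for pairs of points of `C`.
  set C := Metric.ball x δ ∩ interior N with hC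
  have hCU : C ⊆ interior U := fun z hz => interior_mono hNU hz.2
  have hcl : ∀ y ∈ Metric.ball x δ ∩ N, y ∈ closure C := by
    rintro y ⟨hy, hyN⟩
    apply Metric.isOpen_ball.inter_closure
    refine ⟨hy, ?_⟩
    rw [hc.closure_interior_eq_closure_of_nonempty_interior hi]
    exact subset_closure hyN
  have hconv : Convex ℝ C := (convex_ball _ _).inter hc.interior
  have key : ∀ p ∈ C ×ˢ C, ‖f p.2 - f p.1 - f' x (p.2 - p.1)‖ ≤ ε * ‖p.2 - p.1‖ := by
    rintro ⟨u, v⟩ ⟨hu, hv⟩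
    refine hconv.norm_image_sub_le_of_norm_hasFDerivWithin_le'
      (fun z hz => (h z (hCU hz)).hasFDerivWithinAt) (fun z hz => ?_) hu hv
    rw [← dist_eq_norm]
    exact (H (interior_subset (hCU hz)) hz.1).le
  have hxN : x ∈ N := mem_of_mem_nhdsWithin hx hN
  filter_upwards [hN, self_mem_nhdsWithin, mem_nhdsWithin_of_mem_nhds (Metric.ball_mem_nhds x hδ)]
    with y hyN hyU hyB
  have hcont : ContinuousOn (fun p : F × F => ‖f p.2 - f p.1 - f' x (p.2 - p.1)‖) (U ×ˢ U) :=
    (((hf.comp continuousOn_snd fun p hp => hp.2).sub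
      (hf.comp continuousOn_fst fun p hp => hp.1)).sub (by fun_prop)).norm
  have hsub : C ×ˢ C ⊆ U ×ˢ U := prod_mono (hCU.trans interior_subset) (hCU.trans interior_subset)
  have hmem : ((x, y) : F × F) ∈ closure (C ×ˢ C) := by
    rw [closure_prod_eq]
    exact ⟨hcl x ⟨Metric.mem_ball_self hδ, hxN⟩, hcl y ⟨hyB, hyN⟩⟩
  -- Both sides are continuous in the pair of points, so the estimate on `C ×ˢ C` persists at `(x,
  -- y)`, which lies in its closure because `N` is convex with nonempty interior.
  exact ContinuousWithinAt.closure_le hmem ((hcont _ ⟨hx, hyU⟩).mono hsub)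
    (by fun_prop) key

end LocallyConvex

/-! ### Partial derivatives and differentiability -/

section Partial

variable {n : ℕ} {F : Type*} [NormedAddCommGroup F] [NormedSpace ℝ F]

/-- The standard basis vectors. -/
abbrev stdVec (i : Fin n) : Eucl n := EuclideanSpace.single i (1 : ℝ)

/-- The linear map with prescribed values on the standard basis. -/
def linOfBasis (v : Fin n → F) : Eucl n →L[ℝ] F :=
  ∑ j, (EuclideanSpace.proj j : Eucl n →L[ℝ] ℝ).smulRight (v j)

theorem linOfBasis_apply (v : Fin n → F) (h : Eucl n) : linOfBasis v h = ∑ j, h j • v j := by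
  simp [linOfBasis]

theorem linOfBasis_stdVec (v : Fin n → F) (j : Fin n) : linOfBasis v (stdVec j) = v j := by
  rw [linOfBasis_apply, Finset.sum_eq_single j]
  · simp
  · intro i _ hi
    simp [hi]
  · simp

theorem eq_sum_stdVec (x : Eucl n) : x = ∑ i, x i • stdVec i := by
  ext j
  simp [Finset.sum_apply, Pi.single_apply]

theorem eq_linOfBasis (f : Eucl n →L[ℝ] F) :
    f = linOfBasis fun j => f (stdVec j) := by
  ext h
  rw [linOfBasis_apply]
  conv_lhs => rw [eq_sum_stdVec h]
  simp

theorem continuousOn_linOfBasis {X : Type*} [TopologicalSpace X] {S : Set X} {D : Fin n → X → F}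
    (hD : ∀ j, ContinuousOn (D j) S) : ContinuousOn (fun x => linOfBasis fun j => D j x) S := by
  unfold linOfBasis
  refine continuousOn_finsetSum _ fun j _ => ?_
  exact ((ContinuousLinearMap.smulRightL ℝ (Eucl n) F
    (EuclideanSpace.proj j : Eucl n →L[ℝ] ℝ)).continuous.comp_continuousOn (hD j))

theorem contDiffOn_linOfBasis {m : WithTop ℕ∞} {G : Type*} [NormedAddCommGroup G] [NormedSpace ℝ G]
    {S : Set G} {D : Fin n → G → F} (hD : ∀ j, ContDiffOn ℝ m (D j) S) :
    ContDiffOn ℝ m (fun x => linOfBasis fun j => D j x) S := by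
  unfold linOfBasis
  refine ContDiffOn.sum fun j _ => ?_
  exact ((ContinuousLinearMap.smulRightL ℝ (Eucl n) F
    (EuclideanSpace.proj j : Eucl n →L[ℝ] ℝ)).contDiff.comp_contDiffOn (hD j))

theorem hasDirDerivAt_iff_hasDerivAt {G : Type*} [NormedAddCommGroup G] [NormedSpace ℝ G]
    {f : G → F} {v : F} {x y : G} :
    HasDirDerivAt f v x y ↔ HasDerivAt (fun t : ℝ => f (x + t • y)) v 0 := by
  rw [hasDerivAt_iff_tendsto_slope_zero]
  simp [HasDirDerivAt]

/-- The vector that agrees with `h` in the coordinates from `s` and vanishes in the others. -/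
def truncVec (s : Finset (Fin n)) (h : Eucl n) : Eucl n :=
  WithLp.toLp 2 fun i => if i ∈ s then h i else 0

theorem norm_truncVec_add_le {s : Finset (Fin n)} {i : Fin n} (hi : i ∉ s) (h : Eucl n) {τ : ℝ}
    (hτ : |τ| ≤ |h i|) : ‖truncVec s h + τ • stdVec i‖ ≤ ‖h‖ := by
  rw [EuclideanSpace.norm_eq, EuclideanSpace.norm_eq]
  apply Real.sqrt_le_sqrt
  refine Finset.sum_le_sum fun j _ => ?_
  apply pow_le_pow_left₀ (norm_nonneg _)
  simp only [truncVec, PiLp.add_apply, PiLp.smul_apply, PiLp.single_apply, smul_eq_mul,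
    Real.norm_eq_abs]
  rcases eq_or_ne j i with rfl | hj
  · simpa [hi] using hτ
  · by_cases hjs : j ∈ s <;> simp [hj, hjs]

theorem truncVec_insert {s : Finset (Fin n)} {i : Fin n} (hi : i ∉ s) (h : Eucl n) :
    truncVec (insert i s) h = truncVec s h + h i • stdVec i := by
  ext j
  simp only [truncVec, PiLp.add_apply, PiLp.smul_apply, PiLp.single_apply, smul_eq_mul,
    Finset.mem_insert]
  rcases eq_or_ne j i with rfl | hj
  · simp [hi]
  · simp [hj]

/-- A function with continuous partial derivatives is differentiable. -/
theorem hasFDerivAt_of_partial {O : Set (Eucl n)} (hO : IsOpen O) {f : Eucl n → F}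
    {D : Fin n → Eucl n → F} (hD : ∀ j, ContinuousOn (D j) O)
    (h : ∀ x ∈ O, ∀ j, HasDirDerivAt f (D j x) x (stdVec j)) {x : Eucl n} (hx : x ∈ O) :
    HasFDerivAt f (linOfBasis fun j => D j x) x := by
  rw [hasFDerivAt_iff_isLittleO_nhds_zero, Asymptotics.isLittleO_iff]
  intro ε hε
  -- There are `n` coordinate steps, each with error at most `c * ‖v‖`; the `+ 1` covers `n = 0`.
  set c := ε / (n + 1) with hc
  have hc0 : 0 < c := by positivity
  have hev : ∀ᶠ z in 𝓝 x, z ∈ O ∧ ∀ j, ‖D j z - D j x‖ ≤ c := by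
    refine Filter.Eventually.and (hO.mem_nhds hx) (eventually_all.mpr fun j => ?_)
    have := (hD j).continuousAt (hO.mem_nhds hx)
    filter_upwards [Metric.tendsto_nhds.mp this c hc0] with z hz
    rw [← dist_eq_norm]
    exact hz.le
  obtain ⟨r, hr, H⟩ := Metric.eventually_nhds_iff_ball.mp hev
  filter_upwards [Metric.ball_mem_nhds (0 : Eucl n) hr] with v hv
  have hv' : ‖v‖ < r := by simpa using hv
  have hball : ∀ w : Eucl n, ‖w‖ ≤ ‖v‖ → x + w ∈ Metric.ball x r := by
    intro w hw
    simpa using hw.trans_lt hv'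
  -- Walk from `x` to `x + v` one coordinate at a time; `s` is the set of coordinates already moved.
  have key : ∀ s : Finset (Fin n),
      ‖f (x + truncVec s v) - f x - ∑ j ∈ s, v j • D j x‖ ≤ s.card * (c * ‖v‖) := by
    intro s
    induction s using Finset.induction_on with
    | empty =>
      have : truncVec ∅ v = 0 := by
        ext
        simp [truncVec]
      simp [this]
    | insert i s hi ih =>
      -- Mean value inequality along the `i`-th coordinate line, applied to `f` minus the linear
      -- term. The symmetric interval `[-|v i|, |v i|]` avoids a case distinction on the sign of `v
      -- i` and stays in the ball.
      have hstep : ‖(f (x + truncVec s v + v i • stdVec i) - v i • D i x)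
          - (f (x + truncVec s v + (0 : ℝ) • stdVec i) - (0 : ℝ) • D i x)‖ ≤ c * ‖v i - 0‖ := by
        refine Convex.norm_image_sub_le_of_norm_hasDerivWithin_le
          (f := fun τ : ℝ => f (x + truncVec s v + τ • stdVec i) - τ • D i x)
          (f' := fun τ => D i (x + truncVec s v + τ • stdVec i) - D i x)
          (s := Icc (-|v i|) |v i|) (fun τ hτ => ?_) (fun τ hτ => ?_) (convex_Icc _ _)
          ⟨by simp, by simp⟩ ⟨neg_abs_le _, le_abs_self _⟩
        · have hm := (H _ (hball _ (norm_truncVec_add_le hi v (abs_le.mpr hτ)))).1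
          rw [← add_assoc] at hm
          have h1 := hasDirDerivAt_iff_hasDerivAt.mp (h _ hm i)
          have h2 : HasDerivAt (fun σ : ℝ => f (x + truncVec s v + σ • stdVec i))
              (D i (x + truncVec s v + τ • stdVec i)) τ := by
            have h3 := HasDerivAt.comp_sub_const τ τ ((sub_self τ).symm ▸ h1)
            convert h3 using 3 with σ
            rw [sub_smul]
            abel
          have h4 : HasDerivAt (fun σ : ℝ => σ • D i x) (D i x) τ := by
            simpa using (hasDerivAt_id τ).smul_const (D i x)
          exact (h2.sub h4).hasDerivWithinAt
        · have hm := (H _ (hball _ (norm_truncVec_add_le hi v (abs_le.mpr hτ)))).2 i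
          rwa [← add_assoc] at hm
      have hvi : ‖v i - 0‖ ≤ ‖v‖ := by
        rw [sub_zero]
        exact PiLp.norm_apply_le v i
      rw [Finset.sum_insert hi, Finset.card_insert_of_notMem hi, truncVec_insert hi, ← add_assoc]
      rw [zero_smul, zero_smul, add_zero, sub_zero] at hstep
      calc _ = ‖((f (x + truncVec s v + v i • stdVec i) - v i • D i x) - f (x + truncVec s v))
            + (f (x + truncVec s v) - f x - ∑ j ∈ s, v j • D j x)‖ := by
            congr 1
            abel
        _ ≤ c * ‖v‖ + s.card * (c * ‖v‖) :=
            (norm_add_le _ _).trans (add_le_add (hstep.trans (by gcongr)) ih)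
        _ = _ := by
            push_cast
            ring
  have huniv : truncVec Finset.univ v = v := by
    ext
    simp [truncVec]
  have := key Finset.univ
  rw [huniv, Finset.card_univ, Fintype.card_fin] at this
  rw [linOfBasis_apply]
  refine this.trans ?_
  rw [← mul_assoc]
  gcongr
  rw [hc, mul_div_assoc', div_le_iff₀ (by positivity)]
  nlinarith

end Partial

/-! ### `C^k` maps in terms of Fréchet derivatives -/

section IsCk

variable {n : ℕ} {F : Type*} [NormedAddCommGroup F] [NormedSpace ℝ F]

/-- A function that belongs to a family closed under taking partial derivatives is of class
`C^m`. -/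
theorem contDiffOn_of_partialFamily {S : Set (Eucl n)} (hS : UniqueDiffOn ℝ S) (m : ℕ)
    (a : ∀ l : ℕ, (Fin l → Fin n) → Eucl n → F)
    (hc : ∀ l ≤ m, ∀ i, ContinuousOn (a l i) S)
    (hd : ∀ l < m, ∀ i, ∀ x ∈ S,
      HasFDerivWithinAt (a l i) (linOfBasis fun j => a (l + 1) (Fin.snoc i j) x) S x)
    (i₀ : Fin 0 → Fin n) : ContDiffOn ℝ m (a 0 i₀) S := by
  induction m generalizing a with
  | zero =>
    rw [Nat.cast_zero, contDiffOn_zero]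
    exact hc 0 le_rfl i₀
  | succ m ih =>
    rw [Nat.cast_add, Nat.cast_one, contDiffOn_succ_iff_hasFDerivWithinAt_of_uniqueDiffOn hS]
    refine ⟨by simp, fun x => linOfBasis fun j => a 1 (Fin.snoc i₀ j) x,
      contDiffOn_linOfBasis fun j => ?_, fun x hx => hd 0 m.succ_pos i₀ x hx⟩
    -- Derivatives append letters at the end, so fixing the first letter `j` gives another family
    -- closed under partial derivatives. Its member of index `0` is the `j`-th partial derivative of
    -- `a 0 i₀`.
    have h := ih (fun l i => a (l + 1) (Fin.cons j i : Fin (l + 1) → Fin n))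
      (fun l hl i => hc _ (Nat.succ_le_succ hl) _)
      (fun l hl i x hx => by
        have := hd (l + 1) (Nat.succ_lt_succ hl) (Fin.cons j i : Fin (l + 1) → Fin n) x hx
        simpa only [Fin.cons_snoc_eq_snoc_cons] using this)
    have h0 : (Fin.cons j i₀ : Fin (0 + 1) → Fin n) = Fin.snoc i₀ j := by
      funext r
      rw [show r = 0 from Subsingleton.elim (α := Fin 1) r 0, Fin.cons_zero]
      exact (Fin.snoc_last (α := fun _ => Fin n) j i₀).symm
    simpa only [h0] using h

theorem HasDirDerivAt.congr_of_eventuallyEq {G : Type*} [NormedAddCommGroup G] [NormedSpace ℝ G]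
    {f f₁ : G → F} {v : F} {x y : G} (h : HasDirDerivAt f v x y) (h₁ : f₁ =ᶠ[𝓝 x] f) :
    HasDirDerivAt f₁ v x y := by
  rw [hasDirDerivAt_iff_hasDerivAt] at h ⊢
  have ht : Tendsto (fun t : ℝ => x + t • y) (𝓝 0) (𝓝 x) := by
    have : Continuous fun t : ℝ => x + t • y := by fun_prop
    simpa using this.tendsto 0
  exact h.congr_of_eventuallyEq (ht.eventually h₁)

theorem HasDirDerivAt.dirDeriv_eq {G : Type*} [NormedAddCommGroup G] [NormedSpace ℝ G]
    {f : G → F} {v : F} {x y : G} (h : HasDirDerivAt f v x y) : dirDeriv f y x = v :=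
  Tendsto.limUnder_eq h

theorem HasFDerivAt.hasDirDerivAt {G : Type*} [NormedAddCommGroup G] [NormedSpace ℝ G]
    {f : G → F} {f' : G →L[ℝ] F} {x : G} (h : HasFDerivAt f f' x) (y : G) :
    HasDirDerivAt f (f' y) x y := by
  rw [hasDirDerivAt_iff_hasDerivAt]
  have h1 : HasDerivAt (fun t : ℝ => x + t • y) y 0 := by
    simpa using ((hasDerivAt_id (0 : ℝ)).smul_const y).const_add x
  exact HasFDerivAt.comp_hasDerivAt (0 : ℝ) (by simpa using h) h1

variable {k : ℕ∞} {U : Set (Eucl n)} {f : Eucl n → F}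

/-- The continuous extensions, evaluated at tuples of basis vectors, form a family closed under
partial derivatives. On the interior, continuous partial derivatives give Fréchet differentiability;
continuity of the extensions carries this to all of `U`. -/
theorem IsCk.contDiffOn (hU : IsLocallyConvexSet U) (hU' : HasDenseInterior U)
    (hf : IsCk k f U) : ContDiffOn ℝ k f U := by
  have hS := hU.uniqueDiffOn hU'
  rw [contDiffOn_iff_forall_nat_le]
  intro m hm
  have hk : ∀ l ≤ m, (l : ℕ∞) ≤ k := fun l hl => (Nat.cast_le.mpr hl).trans hm
  have hext : ∀ l : ℕ, ∃ D : Eucl n × (Fin l → Eucl n) → F, l ≤ m →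
      ContinuousOn D (U ×ˢ univ) ∧
        ∀ x ∈ interior U, ∀ y : Fin l → Eucl n, D (x, y) = iterDirDeriv f l y x := by
    intro l
    by_cases hl : l ≤ m
    · obtain ⟨D, h⟩ := hf.exists_extension l (hk l hl)
      exact ⟨D, fun _ => h⟩
    · exact ⟨0, fun h => absurd h hl⟩
  choose D hD using hext
  set a : ∀ l : ℕ, (Fin l → Fin n) → Eucl n → F := fun l i x => D l (x, fun r => stdVec (i r))
    with ha
  have hcont : ∀ l ≤ m, ∀ i, ContinuousOn (a l i) U := by
    intro l hl i
    exact (hD l hl).1.comp (by fun_prop) fun x hx => ⟨hx, mem_univ _⟩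
  have heq : ∀ l ≤ m, ∀ i, ∀ x ∈ interior U,
      a l i x = iterDirDeriv f l (fun r => stdVec (i r)) x :=
    fun l hl i x hx => (hD l hl).2 x hx _
  have hder : ∀ l < m, ∀ i, ∀ x ∈ interior U, ∀ j,
      HasDirDerivAt (a l i) (a (l + 1) (Fin.snoc i j) x) x (stdVec j) := by
    intro l hl i x hx j
    have hy : (fun r => stdVec ((Fin.snoc i j : Fin (l + 1) → Fin n) r))
        = (Fin.snoc (fun r => stdVec (i r)) (stdVec j) : Fin (l + 1) → Eucl n) := by
      funext r
      refine Fin.lastCases ?_ (fun r => ?_) r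
      · simp
      · simp
    obtain ⟨v, hv⟩ := hf.exists_dirDeriv l (hk (l + 1) hl) x hx
      (Fin.snoc (fun r => stdVec (i r)) (stdVec j))
    rw [Fin.init_snoc, Fin.snoc_last] at hv
    rw [heq (l + 1) hl _ x hx, hy]
    simp only [iterDirDeriv, Fin.init_snoc, Fin.snoc_last]
    rw [hv.dirDeriv_eq]
    refine hv.congr_of_eventuallyEq ?_
    filter_upwards [isOpen_interior.mem_nhds hx] with z hz using heq l hl.le i z hz
  have h0 := contDiffOn_of_partialFamily hS m a hcont (fun l hl i x hx =>
    hU.hasFDerivWithinAt_of_continuousOn hU' (hcont l hl.le i)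
      (continuousOn_linOfBasis fun j => hcont (l + 1) hl _)
      (fun z hz => hasFDerivAt_of_partial isOpen_interior
        (fun j => (hcont (l + 1) hl _).mono interior_subset) (fun w hw j => hder l hl i w hw j) hz)
      hx) Fin.elim0
  -- The extension of order `0` agrees with `f` on the interior, hence on `U` by density and
  -- continuity.
  refine h0.congr fun x hx => ?_
  have : EqOn f (a 0 Fin.elim0) (interior U) := fun z hz => (heq 0 (Nat.zero_le _) _ z hz).symm
  exact this.of_subset_closure hf.continuousOn (hcont 0 (Nat.zero_le _) _) interior_subset hU' hx

theorem hasDirDerivAt_iteratedFDerivWithin (hS : UniqueDiffOn ℝ U) {l : ℕ}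
    (hf : ContDiffOn ℝ (l + 1 : ℕ) f U) (v : Fin l → Eucl n) (w : Eucl n) {x : Eucl n}
    (hx : x ∈ interior U) :
    HasDirDerivAt (fun z => iteratedFDerivWithin ℝ l f U z v)
      (iteratedFDerivWithin ℝ (l + 1) f U x (Fin.cons w v)) x w := by
  have hd := (hf.differentiableOn_iteratedFDerivWithin (m := l) (mod_cast l.lt_succ_self) hS) x
    (interior_subset hx)
  have h1 := (hd.hasFDerivWithinAt.continuousMultilinear_apply_const v).hasFDerivAt
    (mem_interior_iff_mem_nhds.mp hx)
  have h2 := HasFDerivAt.hasDirDerivAt h1 w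
  rw [iteratedFDerivWithin_succ_apply_left]
  simpa using h2

/-- The reversal occurs because the derivative taken last uses the last entry of `y` in
`iterDirDeriv`, but the argument of index `0` in `iteratedFDerivWithin`. -/
theorem iterDirDeriv_eq_iteratedFDerivWithin (hS : UniqueDiffOn ℝ U) (l : ℕ)
    (hf : ContDiffOn ℝ l f U) (y : Fin l → Eucl n) {x : Eucl n} (hx : x ∈ interior U) :
    iterDirDeriv f l y x = iteratedFDerivWithin ℝ l f U x (y ∘ Fin.rev) := by
  induction l generalizing x with
  | zero => simp [iterDirDeriv]
  | succ l ih =>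
    have hev : iterDirDeriv f l (Fin.init y) =ᶠ[𝓝 x]
        fun z => iteratedFDerivWithin ℝ l f U z (Fin.init y ∘ Fin.rev) := by
      filter_upwards [isOpen_interior.mem_nhds hx] with z hz
      exact ih (hf.of_le (mod_cast l.le_succ)) _ hz
    have h := (hasDirDerivAt_iteratedFDerivWithin hS hf (Fin.init y ∘ Fin.rev) (y (Fin.last l))
      hx).congr_of_eventuallyEq hev
    simp only [iterDirDeriv]
    rw [h.dirDeriv_eq]
    congr 1
    funext r
    refine Fin.cases ?_ (fun r => ?_) r
    · simp
    · simp [Fin.init, Fin.rev_succ]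

/-- The iterated Fréchet derivative within `U` serves as the required continuous extension. This
direction is needed for compositions. -/
theorem ContDiffOn.isCk (hS : UniqueDiffOn ℝ U) (hf : ContDiffOn ℝ k f U) : IsCk k f U := by
  have hk : ∀ l : ℕ, (l : ℕ∞) ≤ k → ContDiffOn ℝ l f U := fun l hl => hf.of_le (mod_cast hl)
  have hD : ∀ l : ℕ, (l : ℕ∞) ≤ k → ContinuousOn (fun p : Eucl n × (Fin l → Eucl n) =>
      iteratedFDerivWithin ℝ l f U p.1 (p.2 ∘ Fin.rev)) (U ×ˢ univ) := by
    intro l hl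
    have h1 : ContinuousOn (fun p : Eucl n × (Fin l → Eucl n) =>
        iteratedFDerivWithin ℝ l f U p.1) (U ×ˢ univ) :=
      ((hk l hl).continuousOn_iteratedFDerivWithin le_rfl hS).comp continuousOn_fst
        fun p hp => hp.1
    exact h1.eval (by fun_prop)
  refine ⟨hf.continuousOn, fun l hl x hx y => ?_, fun l hl => ?_, fun l hl => ⟨_, hD l hl,
    fun x hx y => (iterDirDeriv_eq_iteratedFDerivWithin hS l (hk l hl) y hx).symm⟩⟩
  · refine ⟨_, (hasDirDerivAt_iteratedFDerivWithin hS (hk _ hl) (Fin.init y ∘ Fin.rev)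
      (y (Fin.last l)) hx).congr_of_eventuallyEq ?_⟩
    filter_upwards [isOpen_interior.mem_nhds hx] with z hz
    exact iterDirDeriv_eq_iteratedFDerivWithin hS l
      ((hk _ hl).of_le (mod_cast l.le_succ)) _ hz
  · refine ((hD l hl).mono (prod_mono interior_subset subset_rfl)).congr fun p hp => ?_
    exact iterDirDeriv_eq_iteratedFDerivWithin hS l (hk l hl) _ hp.1

end IsCk

/-! ### Iterated partial derivatives and their symmetry -/

theorem count_ofFn {X : Type*} [DecidableEq X] {l : ℕ} (i : Fin l → X) (r : X) :
    (List.ofFn i).count r = (Finset.univ.filter fun m => i m = r).card := by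
  rw [← Multiset.coe_count, ← Fin.univ_val_map, Multiset.count_map]
  simp only [eq_comm (a := r)]
  rfl

theorem card_finSigma_fst_eq {n : ℕ} (α : Fin n → ℕ) (r : Fin n) :
    (Finset.univ.filter fun l : Fin (∑ i, α i) => (finSigmaFinEquiv.symm l).1 = r).card = α r := by
  have h : (Finset.univ.filter fun l : Fin (∑ i, α i) => (finSigmaFinEquiv.symm l).1 = r)
      = (Finset.univ : Finset (Fin (α r))).map
        ((Function.Embedding.sigmaMk (β := fun i => Fin (α i)) r).trans
          (finSigmaFinEquiv (n := α)).toEmbedding) := by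
    ext l
    simp only [Finset.mem_filter, Finset.mem_univ, true_and, Finset.mem_map,
      Function.Embedding.trans_apply, Equiv.coe_toEmbedding]
    constructor
    · intro h
      subst h
      exact ⟨(finSigmaFinEquiv.symm l).2, finSigmaFinEquiv.apply_symm_apply l⟩
    · rintro ⟨a, rfl⟩
      rw [Equiv.symm_apply_apply]
      rfl
  rw [h, Finset.card_map, Finset.card_univ, Fintype.card_fin]

theorem card_indexSeq_eq {n : ℕ} (α : Fin n → ℕ) (r : Fin n) :
    (Finset.univ.filter fun l => indexSeq α l = r).card = α r :=
  card_finSigma_fst_eq α r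

theorem order_add {n : ℕ} (α β : Fin n → ℕ) : order (α + β) = order α + order β := by
  simp [order, Finset.sum_add_distrib]

theorem order_single {n : ℕ} (i : Fin n) : order (Pi.single i 1 : Fin n → ℕ) = 1 := by
  simp [order]

theorem order_zero {n : ℕ} : order (0 : Fin n → ℕ) = 0 := by
  simp [order]

/-- The multi-index that counts the occurrences of the letters in a word. -/
def countIndex {n l : ℕ} (i : Fin l → Fin n) : Fin n → ℕ :=
  fun r => (Finset.univ.filter fun m => i m = r).card

theorem order_countIndex {n l : ℕ} (i : Fin l → Fin n) : order (countIndex i) = l := by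
  unfold order countIndex
  rw [← Finset.card_eq_sum_card_fiberwise (fun _ _ => Finset.mem_univ _)]
  simp

section WordDeriv

variable {n : ℕ} {F : Type*} [NormedAddCommGroup F] [NormedSpace ℝ F]

/-- The iterated partial derivative within `S` in the directions of the letters of a word. -/
def wordDeriv (S : Set (Eucl n)) (f : Eucl n → F) : List (Fin n) → Eucl n → F
  | [] => f
  | i :: w => fun x => fderivWithin ℝ (wordDeriv S f w) S x (stdVec i)

/-- The partial derivative `∂^α f` within `S`. -/
def multiDeriv (S : Set (Eucl n)) (f : Eucl n → F) (α : Fin n → ℕ) : Eucl n → F :=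
  wordDeriv S f (List.ofFn (indexSeq α))

variable {S : Set (Eucl n)} {f : Eucl n → F}

theorem contDiffOn_wordDeriv (hS : UniqueDiffOn ℝ S) (w : List (Fin n)) (m : ℕ)
    (hf : ContDiffOn ℝ (w.length + m : ℕ) f S) : ContDiffOn ℝ m (wordDeriv S f w) S := by
  induction w generalizing m with
  | nil => simpa [wordDeriv] using hf
  | cons i w ih =>
    have h : ContDiffOn ℝ (m + 1 : ℕ) (wordDeriv S f w) S := by
      apply ih
      convert hf using 2
      simp
      omega
    exact (h.fderivWithin hS (mod_cast le_rfl)).clm_apply contDiffOn_const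

theorem iteratedFDerivWithin_stdVec (hS : UniqueDiffOn ℝ S) (l : ℕ) (hf : ContDiffOn ℝ l f S)
    (i : Fin l → Fin n) {x : Eucl n} (hx : x ∈ S) :
    iteratedFDerivWithin ℝ l f S x (fun r => stdVec (i r)) = wordDeriv S f (List.ofFn i) x := by
  induction l generalizing x with
  | zero => simp [wordDeriv]
  | succ l ih =>
    have hd := (hf.differentiableOn_iteratedFDerivWithin (m := l) (mod_cast l.lt_succ_self) hS) x
      hx
    rw [iteratedFDerivWithin_succ_apply_left, List.ofFn_succ]
    simp only [wordDeriv]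
    rw [← fderivWithin_congr (fun z hz => ih (hf.of_le (mod_cast l.le_succ))
      (fun r => i r.succ) hz) (ih (hf.of_le (mod_cast l.le_succ)) (fun r => i r.succ) hx),
      fderivWithin_continuousMultilinear_apply_const (hS x hx) hd]
    simp [Fin.tail_def]

/-- Adjacent letters may be swapped by symmetry of the second derivative within `S`, which holds at
every point of `S` because `S` lies in the closure of its interior. -/
theorem wordDeriv_perm (hS : UniqueDiffOn ℝ S) (hS' : HasDenseInterior S) {w w' : List (Fin n)}
    (h : w.Perm w') (hf : ContDiffOn ℝ (w.length : ℕ) f S) :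
    EqOn (wordDeriv S f w) (wordDeriv S f w') S := by
  induction h with
  | nil => exact fun _ _ => rfl
  | cons i h ih =>
    intro x hx
    have h' := ih (hf.of_le (by simp))
    simp only [wordDeriv]
    rw [fderivWithin_congr h' (h' hx)]
  | @swap j i w =>
    intro x hx
    have h2 : ContDiffOn ℝ (2 : ℕ) (wordDeriv S f w) S := contDiffOn_wordDeriv hS w 2 hf
    have hsymm := (h2 x hx).isSymmSndFDerivWithinAt (by simp) hS (hS' hx) hx
    have hd : DifferentiableWithinAt ℝ (fderivWithin ℝ (wordDeriv S f w) S) S x :=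
      (h2.fderivWithin (m := 1) hS (by norm_num)).differentiableOn one_ne_zero x hx
    have key : ∀ a b : Fin n, wordDeriv S f (a :: b :: w) x
        = fderivWithin ℝ (fderivWithin ℝ (wordDeriv S f w) S) S x (stdVec a) (stdVec b) := by
      intro a b
      simp only [wordDeriv]
      rw [fderivWithin_clm_apply (hS x hx) hd (differentiableWithinAt_const _)]
      simp
    rw [key, key]
    exact hsymm.eq _ _
  | trans h₁ h₂ ih₁ ih₂ =>
    exact (ih₁ hf).trans (ih₂ (by rwa [← h₁.length_eq]))

theorem wordDeriv_eq_multiDeriv (hS : UniqueDiffOn ℝ S) (hS' : HasDenseInterior S)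
    {w : List (Fin n)} (hf : ContDiffOn ℝ (w.length : ℕ) f S) {α : Fin n → ℕ}
    (hα : ∀ r, w.count r = α r) {x : Eucl n} (hx : x ∈ S) :
    wordDeriv S f w x = multiDeriv S f α x := by
  refine wordDeriv_perm hS hS' (List.perm_iff_count.mpr fun r => ?_) hf hx
  rw [hα, count_ofFn, card_indexSeq_eq]

theorem iteratedFDerivWithin_eq_multiDeriv (hS : UniqueDiffOn ℝ S) (hS' : HasDenseInterior S)
    {l : ℕ} (hf : ContDiffOn ℝ l f S) (i : Fin l → Fin n) {x : Eucl n} (hx : x ∈ S) :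
    iteratedFDerivWithin ℝ l f S x (fun r => stdVec (i r)) = multiDeriv S f (countIndex i) x := by
  rw [iteratedFDerivWithin_stdVec hS l hf i hx]
  refine wordDeriv_eq_multiDeriv hS hS' (by simpa using hf) (fun r => ?_) hx
  rw [count_ofFn, countIndex]

theorem contDiffOn_multiDeriv (hS : UniqueDiffOn ℝ S) (α : Fin n → ℕ) (m : ℕ)
    (hf : ContDiffOn ℝ (order α + m : ℕ) f S) : ContDiffOn ℝ m (multiDeriv S f α) S :=
  contDiffOn_wordDeriv hS _ m (by simpa using hf)

theorem hasFDerivWithinAt_multiDeriv (hS : UniqueDiffOn ℝ S) (hS' : HasDenseInterior S)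
    (α : Fin n → ℕ) (hf : ContDiffOn ℝ (order α + 1 : ℕ) f S) {x : Eucl n} (hx : x ∈ S) :
    HasFDerivWithinAt (multiDeriv S f α)
      (linOfBasis fun j => multiDeriv S f (α + Pi.single j 1) x) S x := by
  have hd : DifferentiableWithinAt ℝ (multiDeriv S f α) S x :=
    (contDiffOn_multiDeriv hS α 1 hf).differentiableOn (by simp) x hx
  have h : (fun j => multiDeriv S f (α + Pi.single j 1) x)
      = fun j => fderivWithin ℝ (multiDeriv S f α) S x (stdVec j) := by
    funext j
    refine (wordDeriv_eq_multiDeriv hS hS' (w := j :: List.ofFn (indexSeq α)) (by simpa using hf)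
      (fun r => ?_) hx).symm
    rw [List.count_cons, count_ofFn, card_indexSeq_eq]
    rcases eq_or_ne j r with rfl | hr
    · simp
    · simp [hr, hr.symm]
  rw [h, ← eq_linOfBasis]
  exact hd.hasFDerivWithinAt

theorem multiDeriv_congr {f' : Eucl n → F} (h : EqOn f f' S) (α : Fin n → ℕ) :
    EqOn (multiDeriv S f α) (multiDeriv S f' α) S := by
  unfold multiDeriv
  induction List.ofFn (indexSeq α) with
  | nil => exact h
  | cons i w ih =>
    intro x hx
    simp only [wordDeriv]
    rw [fderivWithin_congr ih (ih hx)]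

/-- The derivative within `S` is continuous on `S` and agrees with the iterated directional
derivative on the interior, so it is the continuous extension. -/
theorem partialDeriv_eq_multiDeriv (hS : UniqueDiffOn ℝ S) (hS' : HasDenseInterior S)
    (α : Fin n → ℕ) (hf : ContDiffOn ℝ (order α : ℕ) f S) {x : Eucl n} (hx : x ∈ S) :
    partialDeriv S f α x = multiDeriv S f α x := by
  refine extendFrom_eq (hS' hx) ?_
  have hc : Tendsto (multiDeriv S f α) (𝓝[interior S] x) (𝓝 (multiDeriv S f α x)) :=
    ((contDiffOn_multiDeriv hS α 0 hf).continuousOn x hx).mono interior_subset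
  refine hc.congr' ?_
  filter_upwards [self_mem_nhdsWithin] with z hz
  rw [iterDirDeriv_eq_iteratedFDerivWithin hS _ hf _ hz]
  have := iteratedFDerivWithin_eq_multiDeriv hS hS' hf (indexSeq α ∘ Fin.rev)
    (interior_subset hz)
  -- Reversing the word does not change its letter counts.
  rw [show countIndex (indexSeq α ∘ Fin.rev) = α from ?_] at this
  · exact this.symm
  · funext r
    rw [← card_indexSeq_eq α r]
    exact Finset.card_equiv Fin.revPerm (by simp)

/-- A family of functions closed under partial derivatives consists of the partial derivatives
of its first member. -/
theorem multiDeriv_eq_of_family (hS : UniqueDiffOn ℝ S) {a : (Fin n → ℕ) → Eucl n → F}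
    (ha : ∀ α, ∀ x ∈ S, HasFDerivWithinAt (a α) (linOfBasis fun j => a (α + Pi.single j 1) x) S x)
    (α : Fin n → ℕ) {x : Eucl n} (hx : x ∈ S) : multiDeriv S (a 0) α x = a α x := by
  have key : ∀ w : List (Fin n), ∀ z ∈ S, wordDeriv S (a 0) w z = a (fun r => w.count r) z := by
    intro w
    induction w with
    | nil =>
      intro z _
      simp only [wordDeriv, List.count_nil]
      rfl
    | cons i w ih =>
      intro z hz
      simp only [wordDeriv]
      rw [fderivWithin_congr ih (ih z hz), (ha _ z hz).fderivWithin (hS z hz), linOfBasis_stdVec]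
      congr 1
      funext r
      rw [List.count_cons]
      rcases eq_or_ne i r with rfl | hr
      · simp
      · simp [hr, hr.symm]
  rw [multiDeriv, key _ x hx]
  simp only [count_ofFn, card_indexSeq_eq]

end WordDeriv

/-! ### The multivariate Faà di Bruno formula -/

section FaaDiBruno

variable {s t : ℕ}

theorem order_blockIndex (α : Fin s → ℕ) (P : OrderedFinpartition (order α)) (m : Fin P.length) :
    order (blockIndex α P m) = P.partSize m :=
  order_countIndex fun a => indexSeq α (P.emb m a)

theorem faaDiBruno_congr {α : Fin s → ℕ} {β : Fin t → ℕ} {x y : (Fin s → ℕ) → Fin t → ℝ}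
    (h : ∀ γ, order γ ≤ order α → x γ = y γ) : faaDiBruno α β x = faaDiBruno α β y := by
  unfold faaDiBruno
  refine Finset.sum_congr rfl fun P _ => Finset.sum_congr rfl fun i _ =>
    Finset.prod_congr rfl fun m _ => ?_
  rw [h]
  rw [order_blockIndex]
  exact P.partSize_le m

/-- Each pair of a partition `P` and a tuple `i` contributes to exactly one `β`, the letter count of
`i`; its order is the number of blocks of `P`, hence at most `|α|`. -/
theorem sum_faaDiBruno_smul {M : Type*} [AddCommGroup M] [Module ℝ M] (α : Fin s → ℕ)
    (x : (Fin s → ℕ) → Fin t → ℝ) (f : (Fin t → ℕ) → M) :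
    ∑ β ∈ multiLE t (order α), faaDiBruno α β x • f β
      = ∑ P : OrderedFinpartition (order α), ∑ i : Fin P.length → Fin t,
        (∏ m, x (blockIndex α P m) (i m)) • f (countIndex i) := by
  have h : ∀ β ∈ multiLE t (order α), faaDiBruno α β x • f β
      = ∑ P : OrderedFinpartition (order α), ∑ i : Fin P.length → Fin t,
        if countIndex i = β then (∏ m, x (blockIndex α P m) (i m)) • f (countIndex i) else 0 := by
    intro β _
    rw [faaDiBruno, Finset.sum_smul, Finset.sum_filter]
    refine Finset.sum_congr rfl fun P _ => ?_
    split_ifs with hP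
    · rw [Finset.sum_smul, Finset.sum_filter]
      refine Finset.sum_congr rfl fun i _ => ?_
      have hiff : (∀ r, (Finset.univ.filter fun m => i m = r).card = β r) ↔ countIndex i = β :=
        funext_iff.symm
      by_cases hi : countIndex i = β
      · rw [if_pos (hiff.mpr hi), if_pos hi, hi]
      · rw [if_neg (fun h => hi (hiff.mp h)), if_neg hi]
    · refine (Finset.sum_eq_zero fun i _ => if_neg fun hi => hP ?_).symm
      rw [← hi, order_countIndex]
  rw [Finset.sum_congr rfl h, Finset.sum_comm]
  refine Finset.sum_congr rfl fun P _ => ?_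
  rw [Finset.sum_comm]
  refine Finset.sum_congr rfl fun i _ => ?_
  rw [Finset.sum_ite_eq, if_pos]
  rw [mem_multiLE, order_countIndex]
  exact P.length_le

/-- The Faà di Bruno formula for iterated Fréchet derivatives is a sum over partitions. At basis
vectors, expanding the block derivatives of `g` in the standard basis and using multilinearity of
the outer derivative produces the sum over the tuples `i`. -/
theorem multiDeriv_comp {F : Type*} [NormedAddCommGroup F] [NormedSpace ℝ F]
    {S : Set (Eucl s)} {T : Set (Eucl t)} (hS : UniqueDiffOn ℝ S) (hS' : HasDenseInterior S)
    (hT : UniqueDiffOn ℝ T) (hT' : HasDenseInterior T) {g : Eucl s → Eucl t} {ψ : Eucl t → F}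
    (hgST : MapsTo g S T) (α : Fin s → ℕ) (hg : ContDiffOn ℝ (order α : ℕ) g S)
    (hψ : ContDiffOn ℝ (order α : ℕ) ψ T) {x : Eucl s} (hx : x ∈ S) :
    multiDeriv S (ψ ∘ g) α x = ∑ β ∈ multiLE t (order α),
      faaDiBruno α β (fun γ i => multiDeriv S g γ x i) • multiDeriv T ψ β (g x) := by
  rw [sum_faaDiBruno_smul, multiDeriv,
    ← iteratedFDerivWithin_stdVec hS _ (hψ.comp hg hgST) _ hx,
    iteratedFDerivWithin_comp (hψ _ (hgST hx)) (hg x hx) hT hS hx hgST le_rfl]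
  simp only [FormalMultilinearSeries.taylorComp, sum_apply]
  refine Finset.sum_congr rfl fun P _ => ?_
  rw [FormalMultilinearSeries.compAlongOrderedFinpartition_apply,
    OrderedFinpartition.applyOrderedFinpartition_apply]
  have h1 : (fun m : Fin P.length => (ftaylorSeriesWithin ℝ g S x (P.partSize m))
      ((fun r => stdVec (indexSeq α r)) ∘ P.emb m))
      = fun m => ∑ i, multiDeriv S g (blockIndex α P m) x i • stdVec i := by
    funext m
    rw [← eq_sum_stdVec]
    exact iteratedFDerivWithin_eq_multiDeriv hS hS' (hg.of_le (mod_cast P.partSize_le m))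
      (fun a => indexSeq α (P.emb m a)) hx
  rw [h1, ContinuousMultilinearMap.map_sum]
  refine Finset.sum_congr rfl fun i _ => ?_
  rw [ContinuousMultilinearMap.map_smul_univ]
  congr 1
  exact iteratedFDerivWithin_eq_multiDeriv hT hT' (hψ.of_le (mod_cast P.length_le)) i (hgST hx)

end FaaDiBruno

/-! ### Normalized monomials -/

/-- The `b`-th derivative of `x ↦ x ^ n / n!`. -/
def divPow (n b : ℕ) (x : ℝ) : ℝ :=
  if b ≤ n then x ^ (n - b) / ((n - b)! : ℝ) else 0

theorem hasDerivAt_divPow (n b : ℕ) (x : ℝ) :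
    HasDerivAt (divPow n b) (divPow n (b + 1) x) x := by
  unfold divPow
  by_cases h : b + 1 ≤ n
  · obtain ⟨m, rfl⟩ := Nat.exists_eq_add_of_le h
    simp only [if_pos h, if_pos (Nat.le_of_succ_le h)]
    rw [show b + 1 + m - b = m + 1 by omega, show b + 1 + m - (b + 1) = m by omega]
    refine ((hasDerivAt_pow (m + 1) x).div_const (((m + 1)! : ℕ) : ℝ)).congr_deriv ?_
    rw [Nat.factorial_succ]
    push_cast
    have : (m ! : ℝ) ≠ 0 := by exact_mod_cast m.factorial_ne_zero
    field_simp
  · rw [if_neg h]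
    by_cases h' : b ≤ n
    · have : n - b = 0 := by omega
      simpa [if_pos h', this] using hasDerivAt_const x (1 : ℝ)
    · simpa [if_neg h'] using hasDerivAt_const x (0 : ℝ)

theorem divPow_zero (n b : ℕ) : divPow n b 0 = if b = n then 1 else 0 := by
  unfold divPow
  rcases lt_trichotomy b n with h | rfl | h
  · rw [if_pos h.le, if_neg h.ne, zero_pow (by omega), zero_div]
  · simp
  · rw [if_neg h.not_ge, if_neg h.ne']

theorem divPow_add_left (b m : ℕ) (x : ℝ) : divPow (b + m) b x = divPow m 0 x := by
  simp [divPow]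

/-- The binomial theorem for normalized powers; the terms with `d < b` vanish and the others are
indexed by `d - b`. -/
theorem divPow_add (n b : ℕ) (x y : ℝ) :
    divPow n b (x + y) = ∑ d ∈ Finset.range (n + 1), divPow n d y * divPow d b x := by
  by_cases h : b ≤ n
  · obtain ⟨m, rfl⟩ := Nat.exists_eq_add_of_le h
    rw [add_assoc, Finset.sum_range_add, Finset.sum_eq_zero, zero_add, divPow_add_left]
    · simp only [divPow_add_left]
      simp only [divPow, Nat.zero_le, if_true, Nat.sub_zero]
      rw [add_pow, Finset.sum_div]
      refine Finset.sum_congr rfl fun d hd => ?_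
      have hdm : d ≤ m := Nat.lt_succ_iff.mp (Finset.mem_range.mp hd)
      rw [if_pos (by omega), show b + m - (b + d) = m - d by omega,
        Nat.cast_choose ℝ hdm]
      have h1 : (d ! : ℝ) ≠ 0 := by exact_mod_cast d.factorial_ne_zero
      have h2 : (m ! : ℝ) ≠ 0 := by exact_mod_cast m.factorial_ne_zero
      have h3 : ((m - d)! : ℝ) ≠ 0 := by exact_mod_cast (m - d).factorial_ne_zero
      field_simp
    · intro d hd
      rw [divPow.eq_1 d b, if_neg (not_le.mpr (Finset.mem_range.mp hd)), mul_zero]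
  · rw [divPow, if_neg h, Finset.sum_eq_zero]
    intro d hd
    have := Finset.mem_range.mp hd
    rw [divPow.eq_1 d b, if_neg (by omega), mul_zero]

section DivMono

variable {n : ℕ}

/-- The partial derivative `∂^β` of the normalized monomial `z ↦ z^κ / κ!`. -/
def divMono (κ β : Fin n → ℕ) (z : Eucl n) : ℝ :=
  ∏ i, divPow (κ i) (β i) (z i)

theorem divMono_zero_right (κ : Fin n → ℕ) (z : Eucl n) :
    divMono κ 0 z = (∏ i, z i ^ κ i) / ((∏ i, (κ i)! : ℕ) : ℝ) := by
  simp [divMono, divPow, Finset.prod_div_distrib]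

theorem divMono_apply_zero (κ β : Fin n → ℕ) : divMono κ β 0 = if β = κ then 1 else 0 := by
  unfold divMono
  split_ifs with h
  · subst h
    exact Finset.prod_eq_one fun i _ => by simp [divPow_zero]
  · obtain ⟨i, hi⟩ := Function.ne_iff.mp h
    exact Finset.prod_eq_zero (Finset.mem_univ i) (by simp [divPow_zero, hi])

theorem divMono_eq_zero {κ β : Fin n → ℕ} (h : ¬ β ≤ κ) (z : Eucl n) : divMono κ β z = 0 := by
  rw [Pi.le_def, not_forall] at h
  obtain ⟨i, hi⟩ := h
  exact Finset.prod_eq_zero (Finset.mem_univ i) (if_neg hi)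

theorem divMono_add_left (β γ : Fin n → ℕ) (z : Eucl n) :
    divMono (β + γ) β z = divMono γ 0 z :=
  Finset.prod_congr rfl fun i _ => divPow_add_left (β i) (γ i) (z i)

theorem divMono_add (κ β : Fin n → ℕ) (z w : Eucl n) :
    divMono κ β (z + w) = ∑ δ ∈ Fintype.piFinset fun i => Finset.range (κ i + 1),
      divMono κ δ w * divMono δ β z := by
  simp only [divMono, PiLp.add_apply, divPow_add, Finset.prod_univ_sum, Finset.prod_mul_distrib]

theorem hasFDerivAt_divMono (κ β : Fin n → ℕ) (z : Eucl n) :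
    HasFDerivAt (divMono κ β) (linOfBasis fun j => divMono κ (β + Pi.single j 1) z) z := by
  have h : ∀ i ∈ (Finset.univ : Finset (Fin n)), HasFDerivAt
      (fun x : Eucl n => divPow (κ i) (β i) (x i))
      (divPow (κ i) (β i + 1) (z i) • (EuclideanSpace.proj i : Eucl n →L[ℝ] ℝ)) z := by
    intro i _
    exact (hasDerivAt_divPow (κ i) (β i) (z i)).comp_hasFDerivAt z
      (EuclideanSpace.proj i : Eucl n →L[ℝ] ℝ).hasFDerivAt
  refine (HasFDerivAt.finsetProd h).congr_fderiv ?_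
  unfold linOfBasis
  refine Finset.sum_congr rfl fun j _ => ?_
  ext v
  have : divMono κ (β + Pi.single j 1) z
      = (∏ i ∈ Finset.univ.erase j, divPow (κ i) (β i) (z i)) * divPow (κ j) (β j + 1) (z j) := by
    rw [divMono, ← Finset.prod_erase_mul _ _ (Finset.mem_univ j)]
    congr 1
    · refine Finset.prod_congr rfl fun i hi => ?_
      simp [Finset.ne_of_mem_erase hi]
    · simp
  simp only [this]
  simp
  ring

theorem contDiff_divMono (κ β : Fin n → ℕ) {m : WithTop ℕ∞} : ContDiff ℝ m (divMono κ β) := by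
  unfold divMono
  refine contDiff_prod fun i _ => ?_
  unfold divPow
  split_ifs
  · fun_prop
  · fun_prop

theorem multiDeriv_divMono_sub {S : Set (Eucl n)} (hS : UniqueDiffOn ℝ S) (κ β : Fin n → ℕ)
    (w : Eucl n) {z : Eucl n} (hz : z ∈ S) :
    multiDeriv S (fun z => divMono κ 0 (z - w)) β z = divMono κ β (z - w) := by
  refine multiDeriv_eq_of_family hS (a := fun β z => divMono κ β (z - w)) (fun γ x _ => ?_) β hz
  have h := (hasFDerivAt_divMono κ γ (x - w)).comp x ((hasFDerivAt_id x).sub_const w)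
  exact h.hasFDerivWithinAt

/-- Only `κ = β + γ` contributes. In effect, applying `∂^β` to a Taylor polynomial of degree `l`
gives the Taylor polynomial of degree `l - |β|` of the shifted jet. -/
theorem sum_divMono_smul {M : Type*} [AddCommGroup M] [Module ℝ M] (β : Fin n → ℕ) {l : ℕ}
    (hβ : order β ≤ l) (z : Eucl n) (F : (Fin n → ℕ) → M) :
    ∑ κ ∈ multiLE n l, divMono κ β z • F κ
      = ∑ γ ∈ multiLE n (l - order β), divMono γ 0 z • F (β + γ) := by
  have h : ∑ γ ∈ multiLE n (l - order β), divMono γ 0 z • F (β + γ)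
      = ∑ κ ∈ (multiLE n (l - order β)).map (addLeftEmbedding β), divMono κ β z • F κ := by
    rw [Finset.sum_map]
    refine Finset.sum_congr rfl fun γ _ => ?_
    rw [addLeftEmbedding_apply, divMono_add_left]
  rw [h]
  symm
  refine Finset.sum_subset (fun κ hκ => ?_) fun κ hκ hκ' => ?_
  · obtain ⟨γ, hγ, rfl⟩ := Finset.mem_map.mp hκ
    rw [mem_multiLE] at hγ ⊢
    rw [addLeftEmbedding_apply, order_add]
    omega
  · rw [divMono_eq_zero, zero_smul]
    intro hle
    obtain ⟨γ, rfl⟩ := exists_add_of_le hle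
    refine hκ' (Finset.mem_map.mpr ⟨γ, ?_, rfl⟩)
    rw [mem_multiLE, order_add] at hκ
    rw [mem_multiLE]
    omega

end DivMono

/-! ### Taylor's theorem on locally convex sets -/

section Taylor

variable {n : ℕ}

/-- The remainder `∂^α f (x) - ∑_{|β| ≤ m} (x - y)^β / β! ∂^{α + β} f (y)` for a family
`a` in place of the partial derivatives of `f`. -/
def familyRemainder (a : (Fin n → ℕ) → Eucl n → ℝ) (m : ℕ) (α : Fin n → ℕ) (y x : Eucl n) : ℝ :=
  a α x - ∑ β ∈ multiLE n m, divMono β 0 (x - y) * a (α + β) y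

theorem multiLE_zero : multiLE n 0 = {0} := by
  ext β
  rw [mem_multiLE, Finset.mem_singleton]
  constructor
  · intro h
    funext i
    exact (Finset.sum_eq_zero_iff.mp (Nat.le_zero.mp h)) i (Finset.mem_univ i)
  · rintro rfl
    simp [order]

theorem sum_divMono_zero_smul {M : Type*} [AddCommGroup M] [Module ℝ M] (m : ℕ)
    (f : (Fin n → ℕ) → M) : ∑ β ∈ multiLE n m, divMono β 0 (0 : Eucl n) • f β = f 0 := by
  rw [Finset.sum_eq_single 0]
  · simp [divMono_apply_zero]
  · intro β _ hβ
    rw [divMono_apply_zero, if_neg hβ.symm, zero_smul]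
  · intro h
    exact absurd (mem_multiLE.mpr (by simp [order])) h

theorem familyRemainder_self (a : (Fin n → ℕ) → Eucl n → ℝ) (m : ℕ) (α : Fin n → ℕ)
    (y : Eucl n) : familyRemainder a m α y y = 0 := by
  have := sum_divMono_zero_smul m fun β => a (α + β) y
  simp only [smul_eq_mul, add_zero] at this
  rw [familyRemainder, sub_self, this, sub_self]

/-- Differentiating in `x` lowers the degree of the Taylor polynomial by one and raises the
multi-index of the family, which drives the induction in Taylor's theorem. -/
theorem hasFDerivWithinAt_familyRemainder {S : Set (Eucl n)} {a : (Fin n → ℕ) → Eucl n → ℝ}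
    (m : ℕ) (α : Fin n → ℕ) (y : Eucl n) {x : Eucl n}
    (ha : HasFDerivWithinAt (a α) (linOfBasis fun j => a (α + Pi.single j 1) x) S x) :
    HasFDerivWithinAt (familyRemainder a (m + 1) α y)
      (linOfBasis fun j => familyRemainder a m (α + Pi.single j 1) y x) S x := by
  have h1 : ∀ β ∈ multiLE n (m + 1), HasFDerivWithinAt
      (fun z => divMono β 0 (z - y) * a (α + β) y)
      (a (α + β) y • linOfBasis fun j => divMono β (Pi.single j 1) (x - y)) S x := by
    intro β _
    have h := (hasFDerivAt_divMono β 0 (x - y)).comp x ((hasFDerivAt_id x).sub_const y)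
    simp only [zero_add] at h
    exact (h.mul_const (a (α + β) y)).hasFDerivWithinAt
  refine (ha.sub (HasFDerivWithinAt.fun_sum h1)).congr_fderiv ?_
  rw [eq_linOfBasis (_ - _)]
  congr 1
  funext j
  rw [sub_apply, linOfBasis_stdVec, sum_apply, familyRemainder]
  congr 1
  have h2 := sum_divMono_smul (Pi.single j 1) (l := m + 1) (by rw [order_single]; omega) (x - y)
    fun β => a (α + β) y
  rw [order_single, Nat.add_sub_cancel] at h2
  simp only [smul_eq_mul, ← add_assoc] at h2
  rw [← h2]
  refine Finset.sum_congr rfl fun β _ => ?_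
  rw [smul_apply, linOfBasis_stdVec, smul_eq_mul, mul_comm]

theorem norm_linOfBasis_le (v : Fin n → ℝ) {c : ℝ} (hv : ∀ j, |v j| ≤ c) :
    ‖linOfBasis v‖ ≤ n * c := by
  unfold linOfBasis
  refine (norm_sum_le _ _).trans ?_
  refine (Finset.sum_le_card_nsmul _ _ c fun j _ => ?_).trans (by simp)
  rw [ContinuousLinearMap.norm_smulRight_apply]
  have h1 : ‖(EuclideanSpace.proj j : Eucl n →L[ℝ] ℝ)‖ ≤ 1 :=
    ContinuousLinearMap.opNorm_le_bound _ zero_le_one fun x => by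
      rw [one_mul]
      exact PiLp.norm_apply_le x j
  calc _ ≤ 1 * ‖v j‖ := by gcongr
    _ ≤ c := by
      rw [one_mul]
      exact hv j

/-- Induction on `m`, starting from continuity of `a α`. In the step the remainder vanishes at `x =
y` and its partial derivatives are remainders of degree `m`, so the mean value inequality on the
segment from `y` to `x` gains one factor `‖x - y‖`. -/
theorem exists_ball_familyRemainder_le {U : Set (Eucl n)} (hU : IsLocallyConvexSet U)
    {a : (Fin n → ℕ) → Eucl n → ℝ} (m : ℕ) (α : Fin n → ℕ)
    (hc : ∀ β, order β ≤ order α + m → ContinuousOn (a β) U)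
    (hd : ∀ β, order β < order α + m → ∀ x ∈ U,
      HasFDerivWithinAt (a β) (linOfBasis fun j => a (β + Pi.single j 1) x) U x)
    {x₀ : Eucl n} (hx₀ : x₀ ∈ U) {ε : ℝ} (hε : 0 < ε) :
    ∃ r > 0, ∀ x ∈ U ∩ Metric.ball x₀ r, ∀ y ∈ U ∩ Metric.ball x₀ r,
      |familyRemainder a m α y x| ≤ ε * ‖x - y‖ ^ m := by
  induction m generalizing α ε with
  | zero =>
    obtain ⟨r, hr, H⟩ := Metric.continuousWithinAt_iff.mp (hc α le_rfl x₀ hx₀) (ε / 2) (by positivity)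
    refine ⟨r, hr, fun x hx y hy => ?_⟩
    have h1 := H hx.1 hx.2
    have h2 := H hy.1 hy.2
    have h3 : familyRemainder a 0 α y x = a α x - a α y := by
      simp [familyRemainder, multiLE_zero, divMono_zero_right]
    rw [h3, pow_zero, mul_one, ← Real.dist_eq]
    have := dist_triangle_right (a α x) (a α y) (a α x₀)
    linarith
  | succ m ih =>
    have hn : (0 : ℝ) < n + 1 := by positivity
    have hord : ∀ j : Fin n, order (α + Pi.single j 1) = order α + 1 := by
      intro j
      rw [order_add, order_single]
    have h1 := fun j : Fin n => ih (α + Pi.single j 1)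
      (fun β hβ => hc β (by rw [hord] at hβ; omega))
      (fun β hβ => hd β (by rw [hord] at hβ; omega)) (ε := ε / (n + 1)) (by positivity)
    choose ρ hρ H using h1
    obtain ⟨N, hNU, hN, hNc⟩ := hU x₀ hx₀
    obtain ⟨r₀, hr₀, hball⟩ := Metric.mem_nhdsWithin_iff.mp hN
    obtain ⟨r₁, hr₁, hle⟩ : ∃ r₁ > 0, ∀ j, r₁ ≤ ρ j := by
      have : ∀ᶠ r in 𝓝[>] (0 : ℝ), ∀ j, r ≤ ρ j := eventually_all.mpr fun j =>
        mem_nhdsWithin_of_mem_nhds (Iic_mem_nhds (hρ j))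
      obtain ⟨r, hr, hr'⟩ := (this.and self_mem_nhdsWithin).exists
      exact ⟨r, hr', hr⟩
    refine ⟨min r₀ r₁, lt_min hr₀ hr₁, fun x hx y hy => ?_⟩
    have hmem : ∀ z ∈ U ∩ Metric.ball x₀ (min r₀ r₁), z ∈ N := fun z hz =>
      hball ⟨Metric.ball_subset_ball (min_le_left _ _) hz.2, hz.1⟩
    -- Points of `U` close to `x₀` all lie in the convex neighbourhood `N`, so segments between them
    -- stay in `U`.
    have hseg : segment ℝ y x ⊆ U ∩ Metric.ball x₀ (min r₀ r₁) := fun z hz =>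
      ⟨hNU (hNc.segment_subset (hmem y hy) (hmem x hx) hz),
        (convex_ball x₀ _).segment_subset hy.2 hx.2 hz⟩
    have hb : ∀ j, U ∩ Metric.ball x₀ (min r₀ r₁) ⊆ U ∩ Metric.ball x₀ (ρ j) := fun j =>
      inter_subset_inter_right _ (Metric.ball_subset_ball ((min_le_right _ _).trans (hle j)))
    have key := Convex.norm_image_sub_le_of_norm_hasFDerivWithin_le
      (f := familyRemainder a (m + 1) α y)
      (f' := fun z => linOfBasis fun j => familyRemainder a m (α + Pi.single j 1) y z)
      (s := segment ℝ y x) (C := n * (ε / (n + 1) * ‖x - y‖ ^ m))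
      (fun z hz => (hasFDerivWithinAt_familyRemainder m α y
        (hd α (by omega) z (hseg hz).1)).mono fun w hw => (hseg hw).1)
      (fun z hz => norm_linOfBasis_le _ fun j =>
        (H j z (hb j (hseg hz)) y (hb j hy)).trans (by
          have hzy : ‖z - y‖ ≤ ‖x - y‖ := by
            obtain ⟨θ, hθ, rfl⟩ := (segment_eq_image' ℝ y x ▸ hz : _)
            rw [add_sub_cancel_left, norm_smul, Real.norm_eq_abs, abs_of_nonneg hθ.1]
            exact mul_le_of_le_one_left (norm_nonneg _) hθ.2
          gcongr))
      (convex_segment _ _) (left_mem_segment ℝ y x) (right_mem_segment ℝ y x)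
    rw [familyRemainder_self, sub_zero, Real.norm_eq_abs] at key
    refine key.trans ?_
    have : n * (ε / (n + 1)) ≤ ε := by
      rw [mul_div_assoc', div_le_iff₀ hn]
      nlinarith
    calc _ = n * (ε / (n + 1)) * ‖x - y‖ ^ (m + 1) := by ring
      _ ≤ _ := by gcongr

end Taylor

/-! ### Remainders of jets -/

section JetRemainder

variable {n : ℕ} {k : ℕ∞} {A : Set (Eucl n)} {E : Type*} [AddCommGroup E]

theorem Jet.coeff_of_le (f : Jet k A E) {α : Fin n → ℕ} (hα : (order α : ℕ∞) ≤ k) (x : A) :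
    f.coeff α x = f ⟨α, hα⟩ x :=
  dif_pos hα

theorem Jet.coeff_shift (f : Jet k A E) {α β : Fin n → ℕ} {l : ℕ} (hl : (l : ℕ∞) ≤ k)
    (h : order α + order β ≤ l) (x : A) : (f.shift α).coeff β x = f.coeff (α + β) x := by
  have h1 : (order β : ℕ∞) ≤ k - order α := by
    apply ENat.le_sub_of_add_le_left (ENat.natCast_ne_top _)
    exact le_trans (mod_cast h) hl
  rw [Jet.coeff_of_le _ h1]
  rfl

variable [Module ℝ E]

theorem Jet.remainder_shift (f : Jet k A E) {α : Fin n → ℕ} {l m : ℕ} (hl : (l : ℕ∞) ≤ k)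
    (h : order α + m ≤ l) (y x : A) : (f.shift α).remainder m y x
      = f.coeff α x - ∑ β ∈ multiLE n m, divMono β 0 ((x : Eucl n) - y) • f.coeff (α + β) y := by
  unfold Jet.remainder Jet.taylor
  rw [Jet.coeff_shift f hl (by rw [order_zero]; omega), add_zero]
  congr 1
  refine Finset.sum_congr rfl fun β hβ => ?_
  rw [mem_multiLE] at hβ
  rw [Jet.coeff_shift f hl (by omega), divMono_zero_right]
  rfl

theorem Jet.remainder_shift_of_eq (f : Jet k A E) {α : Fin n → ℕ} {l m : ℕ} (hl : (l : ℕ∞) ≤ k)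
    (h : order α + m ≤ l) (x : A) : (f.shift α).remainder m x x = 0 := by
  rw [Jet.remainder_shift f hl h, sub_self, sum_divMono_zero_smul, add_zero, sub_self]

end JetRemainder

/-! ### The jet of a `C^k` function -/

section JetOf

variable {n : ℕ}

/-- The `k`-jet on `A ⊆ U` of a function of class `C^k` on `U`. -/
def jetOf (k : ℕ∞) (U A : Set (Eucl n)) (f : Eucl n → ℝ) : Jet k A ℝ :=
  fun α x => multiDeriv U f α.1 x

variable {k : ℕ∞} {U A : Set (Eucl n)} {f : Eucl n → ℝ}

theorem coeff_jetOf {α : Fin n → ℕ} (hα : (order α : ℕ∞) ≤ k) (x : A) :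
    (jetOf k U A f).coeff α x = multiDeriv U f α x :=
  Jet.coeff_of_le _ hα x

theorem remainder_jetOf {α : Fin n → ℕ} {l m : ℕ} (hl : (l : ℕ∞) ≤ k) (h : order α + m ≤ l)
    (y x : A) : ((jetOf k U A f).shift α).remainder m y x
      = familyRemainder (multiDeriv U f) m α y x := by
  have hk : ∀ β : Fin n → ℕ, order β ≤ l → (order β : ℕ∞) ≤ k := fun β hβ =>
    le_trans (mod_cast hβ) hl
  rw [Jet.remainder_shift _ hl h, coeff_jetOf (hk α (by omega)), familyRemainder]
  congr 1
  refine Finset.sum_congr rfl fun β hβ => ?_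
  rw [mem_multiLE] at hβ
  rw [coeff_jetOf (hk _ (by rw [order_add]; omega)), smul_eq_mul]

/-- Taylor's theorem gives the estimate on a ball around each point of `K`; a Lebesgue number of
this cover makes it uniform for close pairs in `K`. -/
theorem isWhitney_jetOf (hU : IsLocallyConvexSet U) (hU' : HasDenseInterior U)
    (hf : ContDiffOn ℝ k f U) (hA : A ⊆ U) : IsWhitney (jetOf k U A f) := by
  intro l hl α hα q hq K hK ε hε
  have hS := hU.uniqueDiffOn hU'
  have hfl : ∀ m ≤ l, ContDiffOn ℝ m f U := fun m hm =>
    hf.of_le (mod_cast (le_trans (Nat.cast_le.mpr hm) hl))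
  -- A seminorm on `ℝ` is `q 1` times the absolute value; the `+ 1` allows `q 1 = 0`.
  have hε' : 0 < ε / (q 1 + 1) := div_pos hε (by positivity)
  have hloc := fun x₀ : K => exists_ball_familyRemainder_le hU (a := multiDeriv U f)
    (l - order α) α
    (fun β hβ => (contDiffOn_multiDeriv hS β 0 (hfl _ (by omega))).continuousOn)
    (fun β hβ x hx => hasFDerivWithinAt_multiDeriv hS hU' β (hfl _ (by omega)) hx)
    (hA x₀.1.2) hε'
  choose r hr H using hloc
  obtain ⟨δ, hδ, hL⟩ := lebesgue_number_lemma_of_metric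
    (hK.image continuous_subtype_val) (c := fun x₀ : K => Metric.ball (x₀ : Eucl n) (r x₀))
    (fun _ => Metric.isOpen_ball) (by
      rintro _ ⟨x, hx, rfl⟩
      exact mem_iUnion.mpr ⟨⟨x, hx⟩, Metric.mem_ball_self (hr _)⟩)
  refine ⟨δ, hδ, fun x hx y hy h0 hlt => ?_⟩
  obtain ⟨x₀, hx₀⟩ := hL (x : Eucl n) ⟨x, hx, rfl⟩
  have hyx : (y : Eucl n) ∈ Metric.ball (x : Eucl n) δ := by
    rwa [Metric.mem_ball, dist_comm, dist_eq_norm]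
  have key := H x₀ x ⟨hA x.2, hx₀ (Metric.mem_ball_self hδ)⟩ y ⟨hA y.2, hx₀ hyx⟩
  rw [remainder_jetOf hl (by omega), div_le_iff₀ (by positivity)]
  have hq1 : ∀ c : ℝ, q c = |c| * q 1 := by
    intro c
    have := map_smul_eq_mul q c 1
    rwa [smul_eq_mul, mul_one, Real.norm_eq_abs] at this
  rw [hq1]
  calc _ ≤ ε / (q 1 + 1) * ‖(x : Eucl n) - y‖ ^ (l - order α) * (q 1 + 1) := by
        gcongr
        linarith
    _ = _ := by field_simp

end JetOf

/-! ### Remainders of pullbacks -/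

section Nonneg

variable {n : ℕ} {k : ℕ∞} {A : Set (Eucl n)} {E : Type*} [AddCommGroup E] [Module ℝ E]

theorem supPart_nonneg (l : ℕ) (q : Seminorm ℝ E) (K : Set A) (f : Jet k A E) :
    0 ≤ supPart l q K f :=
  Real.iSup_nonneg fun _ => apply_nonneg q _

theorem remPart_nonneg (l : ℕ) (q : Seminorm ℝ E) (K : Set A) (f : Jet k A E) :
    0 ≤ remPart l q K f :=
  Real.iSup_nonneg fun _ => by positivity

end Nonneg

/-! ### The Whitney condition in asymptotic notation, and estimates by the seminorms -/

section Whitney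

open Asymptotics
open scoped Uniformity

variable {n : ℕ} {k : ℕ∞} {A : Set (Eucl n)} {E : Type*} [AddCommGroup E] [Module ℝ E]
  [TopologicalSpace E]

/-- Diagonal pairs may be admitted because the remainder vanishes there. In this form the condition
can be composed with the uniformly continuous map `g` on `K`, even where `g x = g y`. -/
theorem isWhitney_iff_isLittleO {f : Jet k A E} : IsWhitney f ↔
    ∀ l : ℕ, (l : ℕ∞) ≤ k → ∀ α : Fin n → ℕ, order α ≤ l →
      ∀ q : Seminorm ℝ E, Continuous q → ∀ K : Set A, IsCompact K →
        (fun p : A × A => q ((f.shift α).remainder (l - order α) p.2 p.1))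
          =o[𝓤 A ⊓ 𝓟 (K ×ˢ K)] fun p => ‖(p.1 : Eucl n) - p.2‖ ^ (l - order α) := by
  unfold IsWhitney
  refine forall_congr' fun l => forall_congr' fun hl => forall_congr' fun α =>
    forall_congr' fun hα => forall_congr' fun q => forall_congr' fun hq =>
    forall_congr' fun K => forall_congr' fun hK => ?_
  rw [isLittleO_iff]
  refine forall_congr' fun ε => forall_congr' fun hε => ?_
  rw [eventually_inf_principal, Metric.uniformity_basis_dist.eventually_iff]
  refine exists_congr fun δ => and_congr_right fun hδ => ?_
  constructor
  · rintro H ⟨x, y⟩ hxy ⟨hx, hy⟩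
    rw [Real.norm_of_nonneg (apply_nonneg q _), Real.norm_of_nonneg (by positivity)]
    rcases eq_or_ne x y with rfl | hne
    · rw [Jet.remainder_shift_of_eq f hl (by omega), map_zero]
      positivity
    · have h0 : 0 < ‖(x : Eucl n) - y‖ := by
        rw [norm_pos_iff, sub_ne_zero]
        exact fun h => hne (Subtype.ext h)
      have := H x hx y hy h0 (by rwa [← dist_eq_norm])
      rwa [div_le_iff₀ (by positivity)] at this
  · intro H x hx y hy h0 hlt
    have := @H (x, y) (by rwa [← dist_eq_norm] at hlt) ⟨hx, hy⟩
    rw [Real.norm_of_nonneg (apply_nonneg q _), Real.norm_of_nonneg (by positivity)] at this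
    rwa [div_le_iff₀ (by positivity)]

theorem le_supPart {f : Jet k A E} (hf : IsWhitney f) {l : ℕ} (hl : (l : ℕ∞) ≤ k)
    {q : Seminorm ℝ E} (hq : Continuous q) {K : Set A} (hK : IsCompact K) {α : Fin n → ℕ}
    (hα : order α ≤ l) {x : A} (hx : x ∈ K) : q (f.coeff α x) ≤ supPart l q K f :=
  le_ciSup (bddAbove_supPart hf hl hq hK) (⟨α, hα⟩, ⟨x, hx⟩)

theorem le_remPart {f : Jet k A E} (hf : IsWhitney f) {l : ℕ} (hl : (l : ℕ∞) ≤ k)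
    {q : Seminorm ℝ E} (hq : Continuous q) {K : Set A} (hK : IsCompact K) {α : Fin n → ℕ}
    (hα : order α ≤ l) {x y : A} (hx : x ∈ K) (hy : y ∈ K) :
    q ((f.shift α).remainder (l - order α) y x)
      ≤ remPart l q K f * ‖(x : Eucl n) - y‖ ^ (l - order α) := by
  rcases eq_or_ne x y with rfl | hne
  · rw [Jet.remainder_shift_of_eq f hl (by omega), map_zero]
    exact mul_nonneg (remPart_nonneg _ _ _ _) (by positivity)
  · have h0 : 0 < ‖(x : Eucl n) - y‖ := by
      rw [norm_pos_iff, sub_ne_zero]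
      exact fun h => hne (Subtype.ext h)
    rw [← div_le_iff₀ (by positivity)]
    exact le_ciSup (bddAbove_remPart hf hl hq hK) (⟨α, hα⟩, ⟨(x, y), hx, hy, hne⟩)

end Whitney

/-! ### The remainder identity for pullbacks and its estimates -/

section Pullback

variable {s t : ℕ} {k : ℕ∞} {U : Set (Eucl s)} {g : Eucl s → Eucl t}

theorem hasDenseInterior_univ {F : Type*} [TopologicalSpace F] :
    HasDenseInterior (univ : Set F) := by
  simp [HasDenseInterior]

theorem multiDeriv_divMono_comp_sub (hS : UniqueDiffOn ℝ U) (hU' : HasDenseInterior U)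
    {α : Fin s → ℕ} (hg : ContDiffOn ℝ (order α : ℕ) g U) (κ : Fin t → ℕ) (w : Eucl t) {x : Eucl s}
    (hx : x ∈ U) : multiDeriv U (fun z => divMono κ 0 (g z - w)) α x
      = ∑ β ∈ multiLE t (order α),
        faaDiBruno α β (fun γ i => multiDeriv U g γ x i) * divMono κ β (g x - w) := by
  have h := multiDeriv_comp hS hU' uniqueDiffOn_univ hasDenseInterior_univ
    (ψ := fun z => divMono κ 0 (z - w)) (mapsTo_univ g U) α hg
    ((contDiff_divMono κ 0).comp (contDiff_id.sub contDiff_const)).contDiffOn hx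
  refine h.trans (Finset.sum_congr rfl fun β _ => ?_)
  rw [multiDeriv_divMono_sub uniqueDiffOn_univ κ β w (mem_univ _), smul_eq_mul]

/-- Separates the base point `w` from the functions being differentiated: the `divMono δ 0 ∘ g` do
not depend on `w`. -/
theorem multiDeriv_divMono_comp_sub_eq_sum (hS : UniqueDiffOn ℝ U) (hU' : HasDenseInterior U)
    {α : Fin s → ℕ} (hg : ContDiffOn ℝ (order α : ℕ) g U) (κ : Fin t → ℕ) (w : Eucl t) {x : Eucl s}
    (hx : x ∈ U) : multiDeriv U (fun z => divMono κ 0 (g z - w)) α x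
      = ∑ δ ∈ Fintype.piFinset fun i => Finset.range (κ i + 1),
        divMono κ δ (-w) * multiDeriv U (fun z => divMono δ 0 (g z)) α x := by
  have h0 : ∀ δ : Fin t → ℕ, multiDeriv U (fun z => divMono δ 0 (g z)) α x
      = ∑ β ∈ multiLE t (order α),
        faaDiBruno α β (fun γ i => multiDeriv U g γ x i) * divMono δ β (g x) := by
    intro δ
    simpa only [sub_zero] using multiDeriv_divMono_comp_sub hS hU' hg δ 0 hx
  rw [multiDeriv_divMono_comp_sub hS hU' hg κ w hx]
  simp only [h0, sub_eq_add_neg, divMono_add κ _ (g x) (-w), Finset.mul_sum]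
  rw [Finset.sum_comm]
  exact Finset.sum_congr rfl fun δ _ => Finset.sum_congr rfl fun β _ => by ring

theorem continuousOn_faaDiBruno (hS : UniqueDiffOn ℝ U) {α : Fin s → ℕ} (β : Fin t → ℕ)
    (hg : ContDiffOn ℝ (order α : ℕ) g U) :
    ContinuousOn (fun x => faaDiBruno α β fun γ i => multiDeriv U g γ x i) U := by
  unfold faaDiBruno
  refine continuousOn_finsetSum _ fun P _ => continuousOn_finsetSum _ fun i _ =>
    continuousOn_finsetProd _ fun m _ => ?_
  have h : ContinuousOn (multiDeriv U g (blockIndex α P m)) U :=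
    (contDiffOn_multiDeriv hS _ 0 (hg.of_le (by
      rw [order_blockIndex]
      exact_mod_cast P.partSize_le m))).continuousOn
  exact (EuclideanSpace.proj (i m) : Eucl t →L[ℝ] ℝ).continuous.comp_continuousOn h

variable {A : Set (Eucl s)} {B : Set (Eucl t)} {E : Type*} [AddCommGroup E] [Module ℝ E]

theorem coeff_pullback (hS : UniqueDiffOn ℝ U) (hU' : HasDenseInterior U)
    (hg : ContDiffOn ℝ k g U) (hA : A ⊆ U) (hAB : MapsTo g A B) (f : Jet k B E) {α : Fin s → ℕ}
    (hα : (order α : ℕ∞) ≤ k) (x : A) : (pullback U g hAB f).coeff α x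
      = ∑ β ∈ multiLE t (order α), faaDiBruno α β (fun γ i => multiDeriv U g γ x i)
        • f.coeff β ⟨g x, hAB x.2⟩ := by
  rw [Jet.coeff_of_le _ hα]
  refine Finset.sum_congr rfl fun β _ => ?_
  congr 1
  refine faaDiBruno_congr fun γ hγ => ?_
  funext i
  rw [partialDeriv_eq_multiDeriv hS hU' γ
    (hg.of_le (mod_cast (le_trans (Nat.cast_le.mpr hγ) hα))) (hA x.2)]

theorem pullback_add (hAB : MapsTo g A B) (f₁ f₂ : Jet k B E) :
    pullback U g hAB (f₁ + f₂) = pullback U g hAB f₁ + pullback U g hAB f₂ := by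
  funext α x
  change pullback U g hAB (f₁ + f₂) α x = pullback U g hAB f₁ α x + pullback U g hAB f₂ α x
  simp only [pullback, Jet.coeff_add, smul_add, Finset.sum_add_distrib]

theorem pullback_smul (hAB : MapsTo g A B) (c : ℝ) (f : Jet k B E) :
    pullback U g hAB (c • f) = c • pullback U g hAB f := by
  funext α x
  change pullback U g hAB (c • f) α x = c • pullback U g hAB f α x
  simp only [pullback, Jet.coeff_smul, Finset.smul_sum]
  exact Finset.sum_congr rfl fun β _ => smul_comm _ _ _

/-- Replace each `f_β (g x)` by its Taylor polynomial at `g y` plus remainder. By the chain rule the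
polynomial parts combine into `α`-th derivatives at `x` of `(g - g y)^κ / κ!`, weighted by `f_κ (g
y)`. The derivatives of these functions at `y` reproduce the coefficients of the pullback at `y`, so
the Taylor polynomial of the pullback is accounted for as well. -/
theorem remainder_pullback (hS : UniqueDiffOn ℝ U) (hU' : HasDenseInterior U)
    (hg : ContDiffOn ℝ k g U) (hA : A ⊆ U) (hAB : MapsTo g A B) (f : Jet k B E) {α : Fin s → ℕ}
    {l : ℕ} (hl : (l : ℕ∞) ≤ k) (hα : order α ≤ l) (x y : A) :
    ((pullback U g hAB f).shift α).remainder (l - order α) y x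
      = ∑ β ∈ multiLE t (order α), faaDiBruno α β (fun γ i => multiDeriv U g γ x i)
          • (f.shift β).remainder (l - order β) ⟨g y, hAB y.2⟩ ⟨g x, hAB x.2⟩
        + ∑ κ ∈ multiLE t l,
          ((jetOf k U A fun z => divMono κ 0 (g z - g y)).shift α).remainder (l - order α) y x
            • f.coeff κ ⟨g y, hAB y.2⟩ := by
  have hk : ∀ m ≤ l, (m : ℕ∞) ≤ k := fun m hm => (Nat.cast_le.mpr hm).trans hl
  have hgm : ∀ m ≤ l, ContDiffOn ℝ m g U := fun m hm => hg.of_le (mod_cast hk m hm)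
  set p : (Fin s → ℕ) → (Fin t → ℕ) → A → ℝ :=
    fun α β x => faaDiBruno α β (fun γ i => multiDeriv U g γ x i) with hp
  set gx : B := ⟨g x, hAB x.2⟩
  set gy : B := ⟨g y, hAB y.2⟩
  -- The Taylor polynomial is written as a sum over all `|κ| ≤ l`, independently of `β`, so that the
  -- sums can be interchanged.
  have h1 : ∀ β ∈ multiLE t (order α), f.coeff β gx
      = (f.shift β).remainder (l - order β) gy gx
        + ∑ κ ∈ multiLE t l, divMono κ β (g x - g y) • f.coeff κ gy := by
    intro β hβ
    rw [mem_multiLE] at hβ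
    rw [Jet.remainder_shift f hl (by omega), sum_divMono_smul β (hβ.trans hα), sub_add_cancel]
  have h2 : ∀ κ, ((jetOf k U A fun z => divMono κ 0 (g z - g y)).shift α).remainder
      (l - order α) y x = ∑ β ∈ multiLE t (order α), p α β x * divMono κ β (g x - g y)
        - ∑ η ∈ multiLE s (l - order α), divMono η 0 ((x : Eucl s) - y)
          * ∑ β ∈ multiLE t (order (α + η)), p (α + η) β y * if β = κ then 1 else 0 := by
    intro κ
    rw [remainder_jetOf hl (by omega), familyRemainder,
      multiDeriv_divMono_comp_sub hS hU' (hgm _ hα) κ _ (hA x.2)]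
    congr 1
    refine Finset.sum_congr rfl fun η hη => ?_
    rw [mem_multiLE] at hη
    rw [multiDeriv_divMono_comp_sub hS hU' (hgm _ (by rw [order_add]; omega)) κ _ (hA y.2),
      sub_self]
    simp only [divMono_apply_zero, hp]
  -- At `y` the monomials are evaluated at `g y - g y = 0`, where only `β = κ` survives.
  have h3 : ∑ κ ∈ multiLE t l, (∑ η ∈ multiLE s (l - order α), divMono η 0 ((x : Eucl s) - y)
        * ∑ β ∈ multiLE t (order (α + η)), p (α + η) β y * if β = κ then 1 else 0)
          • f.coeff κ gy
      = ∑ η ∈ multiLE s (l - order α), divMono η 0 ((x : Eucl s) - y)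
        • (pullback U g hAB f).coeff (α + η) y := by
    simp only [Finset.sum_smul, mul_smul]
    rw [Finset.sum_comm]
    refine Finset.sum_congr rfl fun η hη => ?_
    rw [mem_multiLE] at hη
    have hαη : order (α + η) ≤ l := by rw [order_add]; omega
    rw [← Finset.smul_sum, coeff_pullback hS hU' hg hA hAB f (hk _ hαη)]
    congr 1
    rw [Finset.sum_comm]
    refine Finset.sum_congr rfl fun β hβ => ?_
    rw [mem_multiLE] at hβ
    rw [← Finset.smul_sum]
    congr 1
    simp only [ite_smul, one_smul, zero_smul]
    rw [Finset.sum_ite_eq, if_pos (mem_multiLE.mpr (hβ.trans hαη))]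
  rw [Jet.remainder_shift _ hl (by omega), coeff_pullback hS hU' hg hA hAB f (hk _ hα)]
  simp only [h2, sub_smul, Finset.sum_sub_distrib, h3]
  rw [Finset.sum_congr rfl fun β hβ => by rw [h1 β hβ, smul_add], Finset.sum_add_distrib]
  rw [add_sub_assoc]
  congr 2
  simp only [Finset.smul_sum, Finset.sum_smul, mul_smul, hp]
  rw [Finset.sum_comm]

/-- A bound for the remainders of a pullback, uniform in the jet. -/
theorem exists_remainder_pullback_le (hS : UniqueDiffOn ℝ U) (hU' : HasDenseInterior U)
    (hg : ContDiffOn ℝ k g U) (hA : A ⊆ U) (hAB : MapsTo g A B) {α : Fin s → ℕ} {l : ℕ}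
    (hl : (l : ℕ∞) ≤ k) (hα : order α ≤ l) {K : Set A} (hK : IsCompact K) :
    ∃ C : ℝ, 0 ≤ C ∧ ∀ (f : Jet k B E) (q : Seminorm ℝ E), ∀ x ∈ K, ∀ y ∈ K,
      q (((pullback U g hAB f).shift α).remainder (l - order α) y x)
        ≤ ∑ β ∈ multiLE t (order α),
            C * q ((f.shift β).remainder (l - order β) ⟨g y, hAB y.2⟩ ⟨g x, hAB x.2⟩)
          + ∑ κ ∈ multiLE t l, ∑ δ ∈ Fintype.piFinset fun i => Finset.range (κ i + 1),
            C * (|((jetOf k U A fun z => divMono δ 0 (g z)).shift α).remainder (l - order α) y x|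
              * q (f.coeff κ ⟨g y, hAB y.2⟩)) := by
  have hk : ∀ m ≤ l, (m : ℕ∞) ≤ k := fun m hm => (Nat.cast_le.mpr hm).trans hl
  have hgm : ∀ m ≤ l, ContDiffOn ℝ m g U := fun m hm => hg.of_le (mod_cast hk m hm)
  have hgA : Continuous fun x : A => g x :=
    hg.continuousOn.comp_continuous continuous_subtype_val fun x => hA x.2
  have h1 : ∀ β : Fin t → ℕ, ∃ C : ℝ, ∀ x ∈ K,
      ‖faaDiBruno α β (fun γ i => multiDeriv U g γ x i)‖ ≤ C := fun β =>
    hK.exists_bound_of_continuousOn ((continuousOn_faaDiBruno hS β (hgm _ hα)).comp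
      continuous_subtype_val.continuousOn fun x _ => hA x.2)
  choose C₁ hC₁ using h1
  have h2 : ∀ κ δ : Fin t → ℕ, ∃ C : ℝ, ∀ y ∈ K, ‖divMono κ δ (-g (y : Eucl s))‖ ≤ C :=
    fun κ δ => hK.exists_bound_of_continuousOn
      (((contDiff_divMono κ δ (m := 0)).continuous.comp hgA.neg).continuousOn)
  choose C₂ hC₂ using h2
  obtain ⟨C, hC⟩ : ∃ C : ℝ, 0 ≤ C ∧ (∀ β ∈ multiLE t (order α), C₁ β ≤ C) ∧
      ∀ κ ∈ multiLE t l, ∀ δ ∈ Fintype.piFinset fun i => Finset.range (κ i + 1), C₂ κ δ ≤ C :=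
    ((eventually_ge_atTop 0).and (((Finset.eventually_all _).mpr fun β _ =>
      eventually_ge_atTop (C₁ β)).and ((Finset.eventually_all _).mpr fun κ _ =>
      (Finset.eventually_all _).mpr fun δ _ => eventually_ge_atTop (C₂ κ δ)))).exists
  obtain ⟨hC0, hCβ, hCκ⟩ := hC
  refine ⟨C, hC0, fun f q x hx y hy => ?_⟩
  have hqsum : ∀ {ι : Type} (S : Finset ι) (F : ι → E), q (∑ i ∈ S, F i) ≤ ∑ i ∈ S, q (F i) :=
    fun S F => Finset.le_sum_of_subadditive q (map_zero q).le (map_add_le_add q) S F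
  rw [remainder_pullback hS hU' hg hA hAB f hl hα]
  refine (map_add_le_add q _ _).trans (add_le_add ((hqsum _ _).trans
    (Finset.sum_le_sum fun β hβ => ?_)) ((hqsum _ _).trans (Finset.sum_le_sum fun κ hκ => ?_)))
  · rw [map_smul_eq_mul]
    gcongr
    exact (hC₁ β x hx).trans (hCβ β hβ)
  -- The function `(g - g y)^κ / κ!` varies with `y`; the binomial expansion leaves fixed functions
  -- with coefficients that are bounded for `y ∈ K`.
  · have h3 : ((jetOf k U A fun z => divMono κ 0 (g z - g y)).shift α).remainder (l - order α) y x
        = ∑ δ ∈ Fintype.piFinset fun i => Finset.range (κ i + 1), divMono κ δ (-g y)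
          * ((jetOf k U A fun z => divMono δ 0 (g z)).shift α).remainder (l - order α) y x := by
      simp only [remainder_jetOf (α := α) (m := l - order α) hl (by omega), familyRemainder,
        mul_sub, Finset.sum_sub_distrib]
      rw [multiDeriv_divMono_comp_sub_eq_sum hS hU' (hgm _ hα) κ _ (hA x.2)]
      congr 1
      simp only [Finset.mul_sum]
      rw [Finset.sum_comm]
      refine Finset.sum_congr rfl fun η hη => ?_
      rw [mem_multiLE] at hη
      rw [multiDeriv_divMono_comp_sub_eq_sum hS hU' (hgm _ (by rw [order_add]; omega)) κ _
        (hA y.2), Finset.mul_sum]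
      exact Finset.sum_congr rfl fun δ _ => by ring
    rw [map_smul_eq_mul, h3]
    simp only [← mul_assoc]
    rw [← Finset.sum_mul]
    gcongr
    refine (norm_sum_le _ _).trans (Finset.sum_le_sum fun δ hδ => ?_)
    rw [norm_mul, Real.norm_eq_abs (Jet.remainder _ _ _ _)]
    gcongr
    exact (hC₂ κ δ y hy).trans (hCκ κ hκ δ hδ)

/-- On the compact set `g` is Lipschitz, and the surplus factor `‖x - y‖ ^ (a - b)` is bounded
there. -/
theorem exists_norm_sub_pow_le (hU : IsLocallyConvexSet U) (hg : ContDiffOn ℝ k g U) (hA : A ⊆ U)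
    {K : Set A} (hK : IsCompact K) {a b : ℕ} (hab : b ≤ a) (ha : (a : ℕ∞) ≤ k) :
    ∃ L : ℝ, 0 ≤ L ∧ ∀ x ∈ K, ∀ y ∈ K,
      ‖g (x : Eucl s) - g y‖ ^ a ≤ L * ‖(x : Eucl s) - y‖ ^ b := by
  -- The case `a = 0` must be separate: `k` may be `0`, and then `g` need not be Lipschitz.
  rcases Nat.eq_zero_or_pos a with rfl | ha0
  · obtain rfl : b = 0 := by omega
    exact ⟨1, zero_le_one, fun x _ y _ => by simp⟩
  · have hlip : LocallyLipschitzOn (Subtype.val '' K) g :=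
      (hU.locallyLipschitzOn (hg.of_le (mod_cast (le_trans (Nat.one_le_cast.mpr ha0) ha)))).mono (by
        rintro _ ⟨x, -, rfl⟩
        exact hA x.2)
    have hK' : IsCompact (Subtype.val '' K) := hK.image continuous_subtype_val
    obtain ⟨c, hc⟩ := hlip.exists_lipschitzOnWith_of_compact hK'
    obtain ⟨D, hD⟩ := hK'.isBounded.exists_norm_le
    refine ⟨(c : ℝ) ^ a * (2 * |D|) ^ (a - b), by positivity, fun x hx y hy => ?_⟩
    have h1 : ‖g (x : Eucl s) - g y‖ ≤ c * ‖(x : Eucl s) - y‖ := by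
      simpa only [dist_eq_norm] using hc.dist_le_mul _ ⟨x, hx, rfl⟩ _ ⟨y, hy, rfl⟩
    have h2 : ‖(x : Eucl s) - y‖ ≤ 2 * |D| := by
      have := norm_sub_le (x : Eucl s) y
      have := hD _ ⟨x, hx, rfl⟩
      have := hD _ ⟨y, hy, rfl⟩
      have := le_abs_self D
      linarith
    calc _ ≤ (c * ‖(x : Eucl s) - y‖) ^ a := by gcongr
      _ = (c : ℝ) ^ a * ‖(x : Eucl s) - y‖ ^ (a - b) * ‖(x : Eucl s) - y‖ ^ b := by
        rw [mul_pow, mul_assoc, ← pow_add, Nat.sub_add_cancel hab]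
      _ ≤ _ := by gcongr

end Pullback

/-! ### Pullbacks of Whitney jets -/

section Pullback

open Asymptotics
open scoped Uniformity

variable {s t : ℕ} {k : ℕ∞} {U : Set (Eucl s)} {g : Eucl s → Eucl t}
  {A : Set (Eucl s)} {B : Set (Eucl t)} {E : Type*} [AddCommGroup E] [Module ℝ E]
  [TopologicalSpace E]

theorem continuous_restrict_of_contDiffOn (hg : ContDiffOn ℝ k g U) (hA : A ⊆ U)
    (hAB : MapsTo g A B) : Continuous fun x : A => (⟨g x, hAB x.2⟩ : B) :=
  (hg.continuousOn.comp_continuous continuous_subtype_val fun x => hA x.2).subtype_mk _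

theorem contDiffOn_divMono_comp (hg : ContDiffOn ℝ k g U) (δ : Fin t → ℕ) :
    ContDiffOn ℝ k (fun z => divMono δ 0 (g z)) U :=
  (contDiff_divMono δ 0).comp_contDiffOn hg

/-- In the remainder bound, the first sum is small by the Whitney condition for `f` on `g(K)` and
the Lipschitz estimate, the second by the Whitney condition for the jets of monomials of `g` and
boundedness of `f_κ` on `g(K)`. -/
theorem isWhitney_pullback (hU : IsLocallyConvexSet U) (hU' : HasDenseInterior U)
    (hg : ContDiffOn ℝ k g U) (hA : A ⊆ U) (hAB : MapsTo g A B) {f : Jet k B E}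
    (hf : IsWhitney f) : IsWhitney (pullback U g hAB f) := by
  have hS := hU.uniqueDiffOn hU'
  rw [isWhitney_iff_isLittleO]
  intro l hl α hα q hq K hK
  set G : A → B := fun x => ⟨g x, hAB x.2⟩ with hG
  have hGc : Continuous G := continuous_restrict_of_contDiffOn hg hA hAB
  have hK' : IsCompact (G '' K) := hK.image hGc
  obtain ⟨C, hC0, hC⟩ := exists_remainder_pullback_le (E := E) hS hU' hg hA hAB hl hα hK
  have hmem : ∀ᶠ p : A × A in 𝓤 A ⊓ 𝓟 (K ×ˢ K), p.1 ∈ K ∧ p.2 ∈ K :=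
    mem_inf_of_right (mem_principal_self _)
  have hmain : (fun p : A × A => ∑ β ∈ multiLE t (order α),
        C * q ((f.shift β).remainder (l - order β) (G p.2) (G p.1))
      + ∑ κ ∈ multiLE t l, ∑ δ ∈ Fintype.piFinset fun i => Finset.range (κ i + 1),
        C * (|((jetOf k U A fun z => divMono δ 0 (g z)).shift α).remainder (l - order α) p.2 p.1|
          * q (f.coeff κ (G p.2))))
      =o[𝓤 A ⊓ 𝓟 (K ×ˢ K)] fun p => ‖(p.1 : Eucl s) - p.2‖ ^ (l - order α) := by
    refine (IsLittleO.fun_sum fun β hβ => ?_).add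
      (IsLittleO.fun_sum fun κ hκ => IsLittleO.fun_sum fun δ _ => ?_)
    · rw [mem_multiLE] at hβ
      refine IsLittleO.const_mul_left ?_ C
      have hunif : Tendsto (fun p : A × A => (G p.1, G p.2)) (𝓤 A ⊓ 𝓟 (K ×ˢ K))
          (𝓤 B ⊓ 𝓟 ((G '' K) ×ˢ (G '' K))) :=
        tendsto_inf.mpr ⟨hK.uniformContinuousOn_of_continuous hGc.continuousOn,
          tendsto_principal.mpr (hmem.mono fun p hp =>
            ⟨mem_image_of_mem G hp.1, mem_image_of_mem G hp.2⟩)⟩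
      have h1 := (isWhitney_iff_isLittleO.mp hf l hl β (hβ.trans hα) q hq _ hK').comp_tendsto hunif
      -- Since `|β| ≤ |α|`, the exponent `l - |β|` on the side of `g` is at least the required `l -
      -- |α|`.
      obtain ⟨L, hL0, hL⟩ := exists_norm_sub_pow_le hU hg hA hK
        (show l - order α ≤ l - order β by omega) (le_trans (Nat.cast_le.mpr (Nat.sub_le _ _)) hl)
      refine h1.trans_isBigO (IsBigO.of_bound L ?_)
      filter_upwards [hmem] with p hp
      rw [Function.comp_apply, Real.norm_of_nonneg (by positivity),
        Real.norm_of_nonneg (by positivity)]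
      exact hL _ hp.1 _ hp.2
    · rw [mem_multiLE] at hκ
      refine IsLittleO.const_mul_left ?_ C
      have h1 := isWhitney_iff_isLittleO.mp (isWhitney_jetOf hU hU'
        (contDiffOn_divMono_comp hg δ) hA) l hl α hα (normSeminorm ℝ ℝ) continuous_norm K hK
      obtain ⟨M, hM0, hM⟩ := exists_bound_coeff hf (α := κ)
        (le_trans (Nat.cast_le.mpr hκ) hl) hq hK'
      have h2 : (fun p : A × A => q (f.coeff κ (G p.2))) =O[𝓤 A ⊓ 𝓟 (K ×ˢ K)]
          fun _ => (1 : ℝ) := by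
        refine IsBigO.of_bound M ?_
        filter_upwards [hmem] with p hp
        rw [Real.norm_of_nonneg (apply_nonneg q _), norm_one, mul_one]
        exact hM _ (mem_image_of_mem G hp.2)
      have h3 := h1.mul_isBigO h2
      simp only [mul_one] at h3
      exact h3
  refine IsBigO.trans_isLittleO (IsBigO.of_bound 1 ?_) hmain
  filter_upwards [hmem] with p hp
  rw [one_mul, Real.norm_of_nonneg (apply_nonneg q _)]
  exact (hC f q _ hp.1 _ hp.2).trans (le_abs_self _)

theorem exists_supPart_pullback_le (hU : IsLocallyConvexSet U) (hU' : HasDenseInterior U)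
    (hg : ContDiffOn ℝ k g U) (hA : A ⊆ U) (hAB : MapsTo g A B) {l : ℕ} (hl : (l : ℕ∞) ≤ k)
    {q : Seminorm ℝ E} (hq : Continuous q) {K : Set A} (hK : IsCompact K) :
    ∃ C : ℝ, 0 ≤ C ∧ ∀ f : Jet k B E, IsWhitney f → supPart l q K (pullback U g hAB f)
      ≤ C * supPart l q ((fun x : A => (⟨g x, hAB x.2⟩ : B)) '' K) f := by
  have hS := hU.uniqueDiffOn hU'
  have hk : ∀ m ≤ l, (m : ℕ∞) ≤ k := fun m hm => (Nat.cast_le.mpr hm).trans hl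
  have hK' := hK.image (continuous_restrict_of_contDiffOn hg hA hAB)
  have h1 : ∀ (α : {α : Fin s → ℕ // order α ≤ l}) (β : Fin t → ℕ), ∃ C : ℝ, ∀ x ∈ K,
      ‖faaDiBruno α.1 β (fun γ i => multiDeriv U g γ x i)‖ ≤ C := fun α β =>
    hK.exists_bound_of_continuousOn ((continuousOn_faaDiBruno hS β
      (hg.of_le (mod_cast hk _ α.2))).comp continuous_subtype_val.continuousOn fun x _ => hA x.2)
  choose C₁ hC₁ using h1
  obtain ⟨C, hC⟩ := (finite_range fun α : {α : Fin s → ℕ // order α ≤ l} =>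
    ∑ β ∈ multiLE t (order α.1), |C₁ α β|).bddAbove
  refine ⟨max C 0, le_max_right _ _, fun f hf => ?_⟩
  refine Real.iSup_le (fun p => ?_) (mul_nonneg (le_max_right _ _) (supPart_nonneg _ _ _ _))
  rw [coeff_pullback hS hU' hg hA hAB f (hk _ p.1.2)]
  refine (Finset.le_sum_of_subadditive q (map_zero q).le (map_add_le_add q) _ _).trans ?_
  refine le_trans ?_ (mul_le_mul_of_nonneg_right
    ((hC ⟨p.1, rfl⟩).trans (le_max_left C 0)) (supPart_nonneg _ _ _ _))
  rw [Finset.sum_mul]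
  refine Finset.sum_le_sum fun β hβ => ?_
  rw [mem_multiLE] at hβ
  rw [map_smul_eq_mul]
  exact mul_le_mul ((hC₁ p.1 β p.2 p.2.2).trans (le_abs_self _))
    (le_supPart hf hl hq hK' (hβ.trans p.1.2) (mem_image_of_mem _ p.2.2))
    (apply_nonneg q _) (abs_nonneg _)

/-- The remainder estimate again, now with a constant independent of `f`. The supremum part over
`g(K)` enters through the coefficients `f_κ (g y)` in the second sum. -/
theorem exists_remPart_pullback_le (hU : IsLocallyConvexSet U) (hU' : HasDenseInterior U)
    (hg : ContDiffOn ℝ k g U) (hA : A ⊆ U) (hAB : MapsTo g A B) {l : ℕ} (hl : (l : ℕ∞) ≤ k)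
    {q : Seminorm ℝ E} (hq : Continuous q) {K : Set A} (hK : IsCompact K) :
    ∃ C : ℝ, 0 ≤ C ∧ ∀ f : Jet k B E, IsWhitney f → remPart l q K (pullback U g hAB f)
      ≤ C * (supPart l q ((fun x : A => (⟨g x, hAB x.2⟩ : B)) '' K) f
          + remPart l q ((fun x : A => (⟨g x, hAB x.2⟩ : B)) '' K) f) := by
  have hS := hU.uniqueDiffOn hU'
  set G : A → B := fun x => ⟨g x, hAB x.2⟩ with hG
  have hK' : IsCompact (G '' K) := hK.image (continuous_restrict_of_contDiffOn hg hA hAB)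
  have key : ∀ α : {α : Fin s → ℕ // order α ≤ l}, ∃ C : ℝ, ∀ f : Jet k B E, IsWhitney f →
      ∀ x ∈ K, ∀ y ∈ K, q (((pullback U g hAB f).shift α.1).remainder (l - order α.1) y x)
        ≤ C * (supPart l q (G '' K) f + remPart l q (G '' K) f)
          * ‖(x : Eucl s) - y‖ ^ (l - order α.1) := by
    rintro ⟨α, hα⟩
    obtain ⟨C, hC0, hC⟩ := exists_remainder_pullback_le (E := E) hS hU' hg hA hAB hl hα hK
    have h1 : ∀ β : Fin t → ℕ, ∃ L : ℝ, 0 ≤ L ∧ (β ∈ multiLE t (order α) → ∀ x ∈ K, ∀ y ∈ K,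
        ‖g (x : Eucl s) - g y‖ ^ (l - order β) ≤ L * ‖(x : Eucl s) - y‖ ^ (l - order α)) := by
      intro β
      by_cases hβ : β ∈ multiLE t (order α)
      · have hβ' := mem_multiLE.mp hβ
        obtain ⟨L, hL0, hL⟩ := exists_norm_sub_pow_le hU hg hA hK
          (show l - order α ≤ l - order β by omega)
          (le_trans (Nat.cast_le.mpr (Nat.sub_le _ _)) hl)
        exact ⟨L, hL0, fun _ => hL⟩
      · exact ⟨0, le_rfl, fun h => absurd h hβ⟩
    choose L hL0 hL using h1
    -- Constants depending only on `g` and `K`; they bound the remainders because the jets of the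
    -- monomials of `g` are Whitney jets.
    set M : (Fin t → ℕ) → ℝ := fun δ =>
      remPart l (normSeminorm ℝ ℝ) K (jetOf k U A fun z => divMono δ 0 (g z)) with hM
    have hM0 : ∀ δ, 0 ≤ M δ := fun δ => remPart_nonneg _ _ _ _
    have hJ : ∀ δ, ∀ x ∈ K, ∀ y ∈ K,
        |((jetOf k U A fun z => divMono δ 0 (g z)).shift α).remainder (l - order α) y x|
          ≤ M δ * ‖(x : Eucl s) - y‖ ^ (l - order α) := fun δ x hx y hy =>
      le_remPart (isWhitney_jetOf hU hU' (contDiffOn_divMono_comp hg δ) hA) hl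
        (q := normSeminorm ℝ ℝ) continuous_norm hK hα hx hy
    refine ⟨∑ β ∈ multiLE t (order α), C * L β + ∑ κ ∈ multiLE t l,
      ∑ δ ∈ Fintype.piFinset fun i => Finset.range (κ i + 1), C * M δ,
      fun f hf x hx y hy => (hC f q x hx y hy).trans ?_⟩
    have hs0 := supPart_nonneg l q (G '' K) f
    have hr0 := remPart_nonneg l q (G '' K) f
    simp only [add_mul, Finset.sum_mul]
    refine add_le_add (Finset.sum_le_sum fun β hβ => ?_)
      (Finset.sum_le_sum fun κ hκ => Finset.sum_le_sum fun δ _ => ?_)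
    · have hβ' := mem_multiLE.mp hβ
      have h2 := le_remPart hf hl hq hK' (hβ'.trans hα) (mem_image_of_mem G hx)
        (mem_image_of_mem G hy)
      have h3 := hL β hβ x hx y hy
      calc _ ≤ C * (remPart l q (G '' K) f * (L β * ‖(x : Eucl s) - y‖ ^ (l - order α))) := by
            refine mul_le_mul_of_nonneg_left (h2.trans ?_) hC0
            exact mul_le_mul_of_nonneg_left h3 hr0
        _ = C * L β * remPart l q (G '' K) f * ‖(x : Eucl s) - y‖ ^ (l - order α) := by ring
        _ ≤ _ := by
            have := hL0 β
            gcongr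
            linarith
    · have hκ' := mem_multiLE.mp hκ
      have h2 := le_supPart hf hl hq hK' hκ' (mem_image_of_mem G hy)
      calc _ ≤ C * ((M δ * ‖(x : Eucl s) - y‖ ^ (l - order α)) * supPart l q (G '' K) f) := by
            refine mul_le_mul_of_nonneg_left ?_ hC0
            exact mul_le_mul (hJ δ x hx y hy) h2 (apply_nonneg q _)
              (mul_nonneg (hM0 δ) (by positivity))
        _ = C * M δ * supPart l q (G '' K) f * ‖(x : Eucl s) - y‖ ^ (l - order α) := by ring
        _ ≤ _ := by
            have := hM0 δ
            gcongr
            linarith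
  choose C₀ hC₀ using key
  obtain ⟨C, hC⟩ := (finite_range C₀).bddAbove
  refine ⟨max C 0, le_max_right _ _, fun f hf => ?_⟩
  have hsr := add_nonneg (supPart_nonneg l q (G '' K) f) (remPart_nonneg l q (G '' K) f)
  refine Real.iSup_le (fun p => ?_) (mul_nonneg (le_max_right _ _) hsr)
  obtain ⟨α, ⟨⟨x, y⟩, hx, hy, hne⟩⟩ := p
  have h0 : 0 < ‖(x : Eucl s) - y‖ := by
    rw [norm_pos_iff, sub_ne_zero]
    exact fun h => hne (Subtype.ext h)
  rw [div_le_iff₀ (by positivity)]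
  refine (hC₀ α f hf x hx y hy).trans ?_
  gcongr
  exact (hC ⟨α, rfl⟩).trans (le_max_left _ _)

variable (E) in
/-- The pullback as a linear map between spaces of Whitney jets. -/
def pullbackLM (hU : IsLocallyConvexSet U) (hU' : HasDenseInterior U)
    (hg : ContDiffOn ℝ k g U) (hA : A ⊆ U) (hAB : MapsTo g A B) :
    WhitneyJets k B E →ₗ[ℝ] WhitneyJets k A E where
  toFun f := ⟨pullback U g hAB f.1, isWhitney_pullback hU hU' hg hA hAB f.2⟩
  map_add' f₁ f₂ := Subtype.ext (pullback_add hAB f₁.1 f₂.1)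
  map_smul' c f := Subtype.ext (pullback_smul hAB c f.1)

variable (E) in
/-- The pullback as a continuous linear map between spaces of Whitney jets. -/
def pullbackCLM (hU : IsLocallyConvexSet U) (hU' : HasDenseInterior U)
    (hg : ContDiffOn ℝ k g U) (hA : A ⊆ U) (hAB : MapsTo g A B) :
    WhitneyJets k B E →L[ℝ] WhitneyJets k A E where
  toLinearMap := pullbackLM E hU hU' hg hA hAB
  cont := by
    refine WithSeminorms.continuous_of_isBounded withSeminorms_whitneyFamily
      withSeminorms_whitneyFamily _ (Seminorm.IsBounded.of_real fun i => ?_)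
    obtain ⟨C₁, hC₁, h₁⟩ := exists_supPart_pullback_le hU hU' hg hA hAB i.hl i.hq i.hK
    obtain ⟨C₂, hC₂, h₂⟩ := exists_remPart_pullback_le hU hU' hg hA hAB i.hl i.hq i.hK
    -- A single seminorm dominates: the same `l` and `q`, with the compact set `g(K)`.
    refine ⟨{⟨i.l, i.hl, i.q, i.hq, (fun x : A => (⟨g x, hAB x.2⟩ : B)) '' i.K,
      i.hK.image (continuous_restrict_of_contDiffOn hg hA hAB)⟩}, C₁ + C₂, fun f => ?_⟩
    rw [Finset.sup_singleton]
    change supPart _ _ _ _ + remPart _ _ _ _ ≤ _ * (supPart _ _ _ _ + remPart _ _ _ _)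
    refine (add_le_add (h₁ f.1 f.2) (h₂ f.1 f.2)).trans ?_
    rw [add_mul]
    gcongr
    exact le_add_of_nonneg_right (remPart_nonneg _ _ _ _)

end Pullback

/-! ### Functoriality of pullbacks -/

section Functoriality

variable {s t u : ℕ} {k : ℕ∞} {U : Set (Eucl s)} {V : Set (Eucl t)} {g : Eucl s → Eucl t}

theorem faaDiBruno_eq_zero {α : Fin s → ℕ} {β : Fin t → ℕ} (h : order α < order β)
    (x : (Fin s → ℕ) → Fin t → ℝ) : faaDiBruno α β x = 0 := by
  unfold faaDiBruno
  rw [Finset.filter_false_of_mem, Finset.sum_empty]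
  intro P _ hP
  have := P.length_le
  omega

/-- In the chain rule for `(g - g x)^γ / γ!` at `x`, the derivatives of the monomial are taken at
`0`, so only `β = γ` remains. Identities between Faà di Bruno polynomials thereby become identities
between derivatives. -/
theorem faaDiBruno_eq_multiDeriv (hS : UniqueDiffOn ℝ U) (hU' : HasDenseInterior U)
    {α : Fin s → ℕ} (hg : ContDiffOn ℝ (order α : ℕ) g U) (γ : Fin t → ℕ) {x : Eucl s}
    (hx : x ∈ U) : faaDiBruno α γ (fun γ i => multiDeriv U g γ x i)
      = multiDeriv U (fun z => divMono γ 0 (g z - g x)) α x := by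
  rw [multiDeriv_divMono_comp_sub hS hU' hg γ (g x) hx, sub_self]
  simp only [divMono_apply_zero, mul_ite, mul_one, mul_zero]
  rw [Finset.sum_ite_eq']
  split_ifs with h
  · rfl
  · rw [mem_multiLE, not_le] at h
    exact faaDiBruno_eq_zero h _

/-- Both sides are the `α`-th derivative at `x` of `(h ∘ g - h (g x))^γ / γ!`, the right one through
the chain rule with inner map `g`. -/
theorem faaDiBruno_comp (hS : UniqueDiffOn ℝ U) (hU' : HasDenseInterior U)
    (hT : UniqueDiffOn ℝ V) (hV' : HasDenseInterior V) {h : Eucl t → Eucl u} (hgUV : MapsTo g U V)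
    {α : Fin s → ℕ} (hg : ContDiffOn ℝ (order α : ℕ) g U) (hh : ContDiffOn ℝ (order α : ℕ) h V)
    (γ : Fin u → ℕ) {x : Eucl s} (hx : x ∈ U) :
    faaDiBruno α γ (fun γ i => multiDeriv U (h ∘ g) γ x i)
      = ∑ β ∈ multiLE t (order α), faaDiBruno α β (fun γ i => multiDeriv U g γ x i)
        * faaDiBruno β γ (fun γ i => multiDeriv V h γ (g x) i) := by
  rw [faaDiBruno_eq_multiDeriv hS hU' (hh.comp hg hgUV) γ hx]
  refine (multiDeriv_comp hS hU' hT hV' (ψ := fun w => divMono γ 0 (h w - h (g x))) hgUV α hg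
    ((contDiff_divMono γ 0).comp_contDiffOn (hh.sub contDiffOn_const)) hx).trans
    (Finset.sum_congr rfl fun β hβ => ?_)
  rw [mem_multiLE] at hβ
  rw [smul_eq_mul, faaDiBruno_eq_multiDeriv hT hV' (hh.of_le (mod_cast hβ)) γ (hgUV hx)]

variable {A : Set (Eucl s)} {B : Set (Eucl t)} {C : Set (Eucl u)} {E : Type*} [AddCommGroup E]
  [Module ℝ E]

theorem pullback_comp (hS : UniqueDiffOn ℝ U) (hU' : HasDenseInterior U)
    (hT : UniqueDiffOn ℝ V) (hV' : HasDenseInterior V) {h : Eucl t → Eucl u} (hgUV : MapsTo g U V)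
    (hg : ContDiffOn ℝ k g U) (hh : ContDiffOn ℝ k h V) (hA : A ⊆ U) (hB : B ⊆ V)
    (hAB : MapsTo g A B) (hBC : MapsTo h B C) (f : Jet k C E) :
    pullback U g hAB (pullback V h hBC f) = pullback U (h ∘ g) (hBC.comp hAB) f := by
  funext ⟨α, hα⟩ x
  rw [← Jet.coeff_of_le (pullback U g hAB (pullback V h hBC f)) hα,
    ← Jet.coeff_of_le (pullback U (h ∘ g) (hBC.comp hAB) f) hα,
    coeff_pullback hS hU' hg hA hAB _ hα, coeff_pullback hS hU' (hh.comp hg hgUV) hA _ f hα]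
  have hα' : (order α : WithTop ℕ∞) ≤ k := mod_cast hα
  simp only [faaDiBruno_comp hS hU' hT hV' hgUV (hg.of_le hα') (hh.of_le hα') _ (hA x.2),
    Finset.sum_smul]
  rw [Finset.sum_comm]
  refine Finset.sum_congr rfl fun β hβ => ?_
  rw [mem_multiLE] at hβ
  rw [coeff_pullback hT hV' hh hB hBC f (le_trans (Nat.cast_le.mpr hβ) hα), Finset.smul_sum]
  simp only [← mul_smul]
  -- One side sums over `|γ| ≤ |β|`, the other over `|γ| ≤ |α|`; the additional terms vanish because
  -- `p_{β,γ} = 0` for `|β| < |γ|`.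
  refine Finset.sum_subset (fun γ hγ => ?_) fun γ _ hγ => ?_
  · rw [mem_multiLE] at hγ ⊢
    exact hγ.trans hβ
  · rw [mem_multiLE, not_le] at hγ
    rw [faaDiBruno_eq_zero hγ, mul_zero, zero_smul]

/-- For a map equal to the identity on `U`, `p_{α,β}` is the `α`-th derivative of `(z - x)^β / β!`
at `x`, a Kronecker delta. Equality on `U` alone suffices, so the result covers composites of a
diffeomorphism with its inverse. -/
theorem pullback_eq_restrict (hS : UniqueDiffOn ℝ U) (hU' : HasDenseInterior U)
    {g : Eucl s → Eucl s} (hg : EqOn g id U) (hA : A ⊆ U) {A' : Set (Eucl s)} (hA' : A' ⊆ A)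
    (hAA : MapsTo g A' A) (f : Jet k A E) : pullback U g hAA f = Jet.restrict hA' f := by
  have hgk : ContDiffOn ℝ k g U := contDiffOn_id.congr hg
  funext ⟨α, hα⟩ x
  have hx : (x : Eucl s) ∈ U := hA (hA' x.2)
  have hgx : g x = x := hg hx
  have key : ∀ β, faaDiBruno α β (fun γ i => multiDeriv U g γ x i) = if α = β then 1 else 0 := by
    intro β
    rw [faaDiBruno_eq_multiDeriv hS hU' (hgk.of_le (mod_cast hα)) _ hx,
      multiDeriv_congr (f' := fun z => divMono β 0 (z - g x)) (fun z hz => by rw [hg hz, id]) _ hx,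
      multiDeriv_divMono_sub hS _ _ _ hx, hgx, sub_self, divMono_apply_zero]
  rw [← Jet.coeff_of_le (pullback U g hAA f) hα, coeff_pullback hS hU' hgk (hA'.trans hA) hAA f hα]
  simp only [key, ite_smul, one_smul, zero_smul]
  rw [Finset.sum_ite_eq, if_pos (mem_multiLE.mpr le_rfl), Jet.coeff_of_le _ hα]
  exact congrArg (f ⟨α, hα⟩) (Subtype.ext hgx)

end Functoriality

end

end WhitneyPullback

/-! ### Assembly of the theorem -/

theorem mainTheorem11 {s t u : ℕ} (k : ℕ∞)
    {E : Type*} [AddCommGroup E] [Module ℝ E] [TopologicalSpace E] [IsTopologicalAddGroup E]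
    [ContinuousSMul ℝ E] [LocallyConvexSpace ℝ E] [T2Space E]
    {U : Set (Eucl s)} {V : Set (Eucl t)} {W : Set (Eucl u)}
    (hU : IsLocallyConvexSet U) (hU' : HasDenseInterior U)
    (hV : IsLocallyConvexSet V) (hV' : HasDenseInterior V)
    (hW : IsLocallyConvexSet W) (hW' : HasDenseInterior W)
    {g : Eucl s → Eucl t} {h : Eucl t → Eucl u}
    (hg : IsCk k g U) (hgUV : MapsTo g U V) (hh : IsCk k h V) (hhVW : MapsTo h V W)
    {A : Set (Eucl s)} {B : Set (Eucl t)} {C : Set (Eucl u)}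
    (hA : A ⊆ U) (hB : B ⊆ V) (hC : C ⊆ W) (hAB : MapsTo g A B) (hBC : MapsTo h B C) :
    -- (a) the pullback is a continuous linear map between spaces of Whitney jets
    (∃ Φ : WhitneyJets k B E →L[ℝ] WhitneyJets k A E,
      ∀ f : WhitneyJets k B E, (Φ f : Jet k A E) = pullback U g hAB f.1) ∧
    -- (b) functoriality
    (IsCk k (h ∘ g) U ∧
      ∀ f : WhitneyJets k C E,
        pullback U g hAB (pullback V h hBC f.1) = pullback U (h ∘ g) (hBC.comp hAB) f.1) ∧
    -- (c) pullbacks along the identity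
    ((∀ f : WhitneyJets k A E, pullback U id (mapsTo_id A) f.1 = f.1) ∧
      ∀ (A' : Set (Eucl s)) (hA' : A' ⊆ A) (f : WhitneyJets k A E),
        pullback U id (fun _ hx => hA' hx) f.1 = Jet.restrict hA' f.1) ∧
    -- `C^k`-diffeomorphisms
    (∀ g' : Eucl t → Eucl s, IsCk k g' V → MapsTo g' V U → LeftInvOn g' g U →
      RightInvOn g' g V → g '' A = B →
      ∃ (hBA : MapsTo g' B A) (Φ : WhitneyJets k B E ≃L[ℝ] WhitneyJets k A E),
        (∀ f : WhitneyJets k B E, (Φ f : Jet k A E) = pullback U g hAB f.1) ∧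
        ∀ f : WhitneyJets k A E, (Φ.symm f : Jet k B E) = pullback V g' hBA f.1) := by
  have hSU := hU.uniqueDiffOn hU'
  have hSV := hV.uniqueDiffOn hV'
  have hgc := hg.contDiffOn hU hU'
  have hhc := hh.contDiffOn hV hV'
  refine ⟨⟨pullbackCLM E hU hU' hgc hA hAB, fun f => rfl⟩,
    ⟨(hhc.comp hgc hgUV).isCk hSU, fun f =>
      pullback_comp hSU hU' hSV hV' hgUV hgc hhc hA hB hAB hBC f.1⟩,
    ⟨fun f => pullback_eq_restrict hSU hU' (fun _ _ => rfl) hA subset_rfl _ f.1,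
      fun A' hA' f => pullback_eq_restrict hSU hU' (fun _ _ => rfl) hA hA' _ f.1⟩, ?_⟩
  intro g' hg' hg'VU hleft hright hgAB
  have hg'c := hg'.contDiffOn hV hV'
  have hBA : MapsTo g' B A := by
    rw [← hgAB]
    rintro _ ⟨x, hx, rfl⟩
    rwa [hleft (hA hx)]
  -- The two composites are pullbacks along `g ∘ g'` and `g' ∘ g`, which equal the identity on `V`
  -- and on `U` respectively.
  refine ⟨hBA, ContinuousLinearEquiv.equivOfInverse (pullbackCLM E hU hU' hgc hA hAB)
    (pullbackCLM E hV hV' hg'c hB hBA) (fun f => Subtype.ext ?_) (fun f => Subtype.ext ?_),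
    fun f => rfl, fun f => rfl⟩
  · exact (pullback_comp hSV hV' hSU hU' hg'VU hg'c hgc hB hA hBA hAB f.1).trans
      (pullback_eq_restrict hSV hV' hright hB subset_rfl _ f.1)
  · exact (pullback_comp hSU hU' hSV hV' hgUV hgc hg'c hA hB hAB hBA f.1).trans
      (pullback_eq_restrict hSU hU' hleft hA subset_rfl _ f.1)
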